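/- **Setting.** Let $\Gamma=\{(\xi,\eta)\in[0,1]^2 : \xi+\eta\le 1\}$ be the reference triangle with vertices $v_1=(0,0)$, $v_2=(0,1)$, $v_3=(1,0)$ and edges $e_{ij}=[v_i,v_j]$, $(i,j)\in\mathcal J=\{(1,2),(1,3),(2,3)\}$, and let $\bm R\nabla n=(\partial_\eta n,-\partial_\xi n)$. For $q\ge 1$, a polytopal basis $U^q$ consists of linearly independent polynomials of degree at most $q$ on $\Gamma$: one vertex function for each vertex, spanning $\mathcal V^q_i$, which vanishes on the edge not containing $v_i$; $q-1$ edge functions for each edge, spanning $\mathcal E^q_{ij}$, which vanish on the two other edges; and $(q-1)(q-2)/2$ cell functions, spanning $\mathcal C^q_{123}$, which vanish on $\partial\Gamma$. The basis $U^q$ is $H^1$-conforming on edges if, for each $k$, the $k$-th edge functions of all three edges have the same trace $t\mapsto n\big((1-t)v_i+t v_j\big)$, $t\in[0,1]$, $i<j$. Let $\bm\phi_1=(1-\xi,-\eta)$, $\bm\phi_2=(\xi,\eta-1)$, $\bm\phi_3=(-\xi,-\eta)$ be the lowest-order Raviart–Thomas functions, belonging to $e_{12},e_{13},e_{23}$ respectively,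 and define the templates $\bm\ell_1=-\bm\phi_3$, $\bm\ell_2=\bm\phi_2$, $\bm\ell_{12}=\bm\phi_2-\bm\phi_3$, $\bm\ell_{13}=-\bm\phi_1-\bm\phi_3$, $\bm\ell_{23}=\bm\phi_2-\bm\phi_1$, $\bm\ell_{123}=\bm\phi_2-\bm\phi_1-\bm\phi_3$. Let $p\ge 0$, let $U^{p+1}$ be a polytopal basis that is $H^1$-conforming on edges and, if $p\ge1$, let $U^p$ be a polytopal basis. The base functions of $\mathcal{RT}^p$ are: * on each edge $e_{ij}$: the lowest-order function belonging to $e_{ij}$, and $\bm R\nabla n$ for the $p$ edge functions $n$ of $U^{p+1}$ on $e_{ij}$; * on the cell: $\bm R\nabla n$ for the cell functions $n$ of $U^{p+1}$ and, if $p\ge1$, the products $n\bm\ell_i$ with $n$ the vertex function of $U^p$ at $v_i$ ($i=1,2$), $n\bm\ell_{ij}$ with $n$ an edge function of $U^p$ on $e_{ij}$ ($(i,j)\in\mathcal J$), and $n\bm\ell_{123}$ with $n$ a cell function of $U^p$. Let $A\subset\mathbb R^2$ be open with a finite conforming mesh of possibly curved triangles. That is, $\overline A=\bigcup_T \bm x_T(\Gamma)$,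 where each $\bm x_T$ is $C^1$ on a neighbourhood of $\Gamma$ with invertible Jacobian $\bm J_T$ on $\Gamma$ ($\det\bm J_T$ may have either sign); each $T$ has three distinct global vertices in a local order $v_1,v_2,v_3$; different elements do not have the same three vertices; for $\xi,\zeta\in\Gamma$ one has $\bm x_T(\xi)=\bm x_{T'}(\zeta)$ if and only if $\xi$ and $\zeta$ have the same barycentric coordinates with respect to the global vertices of $T$ and $T'$ (coordinates at other vertices being zero); and two elements with a common edge order its two vertices in the same way. Consider the functions $\bm u$ such that on each element $T$ $$\bm u(\bm x_T(\xi))=\frac{1}{\det \bm J_T(\xi)}\,\bm J_T(\xi)\,\bm\phi_T(\xi),\qquad \xi\in\operatorname{int}\Gamma ,$$ where $\bm\phi_T$ is a linear combination of the base functions of $\mathcal{RT}^p$ in which the coefficients of the base functions of an edge are the same for all elements containing that edge, while the coefficients of the cell base functions are arbitrary on each element. **Theorem ($H(\mathrm{div},A)$-conformity).** Every such $\bm u$ belongs to $H(\mathrm{div},A)$: $\bm u\in[L^2(A)]^2$ and $\bm u$ has a weak divergence in $L^2(A)$. That is, the triangle $\mathcal{RT}^p$ element is $H(\mathrm{div})$-conforming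 under contravariant Piola mappings. -/

import Mathlib

open MeasureTheory Set
open scoped ContDiff

namespace RTTemplate

/-- The plane `ℝ²` with its Euclidean structure. -/
abbrev Plane : Type := EuclideanSpace ℝ (Fin 2)

/-! ### The space `H(div, A)` -/

/-- `d` is the weak divergence of `u` on the open set `A`:
`∫_A ⟨u, ∇q⟩ = - ∫_A d q` for all `q ∈ C_c^∞(A)`. Here `⟨u x, ∇q x⟩` is `fderiv ℝ q x (u x)`. -/
def IsWeakDiv (A : Set Plane) (u : Plane → Plane) (d : Plane → ℝ) : Prop :=
  ∀ q : Plane → ℝ, ContDiff ℝ ∞ q → HasCompactSupport q → tsupport q ⊆ A →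
    ∫ x in A, fderiv ℝ q x (u x) = - ∫ x in A, d x * q x

/-- `H(div, A) = {u ∈ L²(A)² | div u ∈ L²(A)}`, as a set of representatives. -/
def HDiv (A : Set Plane) : Set (Plane → Plane) :=
  {u | MemLp u 2 (volume.restrict A) ∧
    ∃ d : Plane → ℝ, MemLp d 2 (volume.restrict A) ∧ IsWeakDiv A u d}

/-! ### The reference triangle -/

/-- The closed reference triangle `Γ`. -/
def refTriangle : Set Plane :=
  {ξ | ξ 0 ∈ Icc (0 : ℝ) 1 ∧ ξ 1 ∈ Icc (0 : ℝ) 1 ∧ ξ 0 + ξ 1 ≤ 1}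

/-- The vertices `v₁ = (0,0)`, `v₂ = (0,1)`, `v₃ = (1,0)` (indices shifted by one). -/
noncomputable def refVertex : Fin 3 → Plane := ![!₂[0, 0], !₂[0, 1], !₂[1, 0]]

/-- Barycentric coordinates with respect to `v₁, v₂, v₃`. -/
def bary (ξ : Plane) : Fin 3 → ℝ := ![1 - ξ 0 - ξ 1, ξ 1, ξ 0]

/-- The edges `e₁₂, e₁₃, e₂₃` are numbered `0, 1, 2`; first vertex of an edge. -/
def edgeStart : Fin 3 → Fin 3 := ![0, 0, 1]

/-- Second vertex of an edge. -/
def edgeEnd : Fin 3 → Fin 3 := ![1, 2, 2]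

/-- The point of the edge `e` with parameter `t ∈ [0,1]`, running from the first to the second
vertex of `e`. -/
noncomputable def edgePoint (e : Fin 3) (t : ℝ) : Plane :=
  (1 - t) • refVertex (edgeStart e) + t • refVertex (edgeEnd e)

/-! ### Polynomials and polynomial vector fields on the reference triangle -/

/-- Polynomials in `ξ = X 0` and `η = X 1`. -/
abbrev Poly : Type := MvPolynomial (Fin 2) ℝ

/-- Polynomial vector fields. -/
abbrev PolyField : Type := Fin 2 → Poly

/-- Value of a polynomial at a point. -/
noncomputable def evalPoly (n : Poly) (ξ : Plane) : ℝ := MvPolynomial.eval (fun i => ξ i) n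

/-- Value of a polynomial vector field at a point. -/
noncomputable def evalField (φ : PolyField) (ξ : Plane) : Plane :=
  !₂[evalPoly (φ 0) ξ, evalPoly (φ 1) ξ]

/-- The polynomial vanishes on the edge `e`. -/
def VanishesOnEdge (n : Poly) (e : Fin 3) : Prop :=
  ∀ t ∈ Icc (0 : ℝ) 1, evalPoly n (edgePoint e t) = 0

/-- The rotated gradient `R ∇ n = (∂n/∂η, -∂n/∂ξ)`. -/
noncomputable def rotGrad (n : Poly) : PolyField :=
  ![MvPolynomial.pderiv 1 n, -MvPolynomial.pderiv 0 n]

/-! ### Polytopal bases of the scalar space `U^p(Γ)` -/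

/-- A basis of polynomials of degree at most `p` (with `p ≥ 1`), split into vertex, edge and cell
base functions: one function for each vertex, `p - 1` for each edge, `(p-1)(p-2)/2` for the cell.
Together they are `(p+1)(p+2)/2` linearly independent polynomials. -/
structure PolytopalBasis (p : ℕ) where
  vertex : Fin 3 → Poly
  edge : Fin 3 → Fin (p - 1) → Poly
  cell : Fin ((p - 1) * (p - 2) / 2) → Poly
  vertex_degree : ∀ i, (vertex i).totalDegree ≤ p
  edge_degree : ∀ e k, (edge e k).totalDegree ≤ p
  cell_degree : ∀ k, (cell k).totalDegree ≤ p
  linearIndependent : LinearIndependent ℝ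
    (Sum.elim vertex (Sum.elim (fun m : Fin 3 × Fin (p - 1) => edge m.1 m.2) cell))
  /-- A vertex function vanishes on the edge that does not contain its vertex
  (hence also at the two other vertices). -/
  vertex_vanishes : ∀ i e, edgeStart e ≠ i → edgeEnd e ≠ i → VanishesOnEdge (vertex i) e
  /-- An edge function vanishes on the two other edges. -/
  edge_vanishes : ∀ e k e', e' ≠ e → VanishesOnEdge (edge e k) e'
  /-- A cell function vanishes on the whole boundary. -/
  cell_vanishes : ∀ k e, VanishesOnEdge (cell k) e

/-- `H¹`-conformity of the edge functions: the `k`-th functions of any two edges have the same trace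
when both edges are parametrized from their first to their second vertex, so that two elements that
share an edge see the same `k`-th scalar function on it. -/
def PolytopalBasis.EdgeConforming {p : ℕ} (U : PolytopalBasis p) : Prop :=
  ∀ (k : Fin (p - 1)) (e e' : Fin 3), ∀ t ∈ Icc (0 : ℝ) 1,
    evalPoly (U.edge e k) (edgePoint e t) = evalPoly (U.edge e' k) (edgePoint e' t)

/-! ### The Raviart-Thomas base functions -/

/-- The lowest order Raviart-Thomas functions `φ₁, φ₂, φ₃`; they belong to the edges
`e₁₂, e₁₃, e₂₃`, the only ones on which their normal traces do not vanish. -/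
noncomputable def rtLowest : Fin 3 → PolyField :=
  ![![1 - MvPolynomial.X 0, -MvPolynomial.X 1],
    ![MvPolynomial.X 0, MvPolynomial.X 1 - 1],
    ![-MvPolynomial.X 0, -MvPolynomial.X 1]]

/-- Template fields of the vertices `v₁` and `v₂`. -/
noncomputable def vertexTemplate : Fin 2 → PolyField := ![-rtLowest 2, rtLowest 1]

/-- Template fields of the edges `e₁₂`, `e₁₃`, `e₂₃`. -/
noncomputable def edgeTemplate : Fin 3 → PolyField :=
  ![rtLowest 1 - rtLowest 2, -rtLowest 0 - rtLowest 2, rtLowest 1 - rtLowest 0]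

/-- Template field of the cell. -/
noncomputable def cellTemplate : PolyField := rtLowest 1 - rtLowest 0 - rtLowest 2

/-- The `p + 1` base functions of `RT^p` that belong to the edge `e`: the lowest order function and
the rotated gradients of the edge functions of `U^{p+1}`. -/
noncomputable def rtEdge {p : ℕ} (U' : PolytopalBasis (p + 1)) (e : Fin 3) :
    Option (Fin p) → PolyField
  | none => rtLowest e
  | some k => rotGrad (U'.edge e k)

/-- The products of the base functions of `U^p` with the template fields (the vertex function of
`v₃` is left out). -/
def templateProducts {p : ℕ} (U : PolytopalBasis p) : Set PolyField :=
  {φ | ∃ i : Fin 2, φ = U.vertex i.castSucc • vertexTemplate i} ∪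
  {φ | ∃ (e : Fin 3) (k : Fin (p - 1)), φ = U.edge e k • edgeTemplate e} ∪
  {φ | ∃ k, φ = U.cell k • cellTemplate}

/-- The span of the cell base functions of `RT^p`: the template products (which are present for
`p ≥ 1` only) and the rotated gradients of the cell functions of `U^{p+1}`. -/
noncomputable def rtCell {p : ℕ} (U : 1 ≤ p → PolytopalBasis p) (U' : PolytopalBasis (p + 1)) :
    Submodule ℝ PolyField :=
  Submodule.span ℝ
    ({φ | ∃ hp : 1 ≤ p, φ ∈ templateProducts (U hp)} ∪ {φ | ∃ k, φ = rotGrad (U'.cell k)})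

/-! ### Meshes and the global finite element space -/

/-- A conforming mesh of (possibly curved) triangles, with vertex set `V` and element set `K`. -/
structure Mesh (V K : Type*) where
  /-- The global vertices of an element, in the local order `v₁, v₂, v₃`. -/
  vtx : K → Fin 3 → V
  /-- The map from the reference triangle to an element; only its values near `Γ` matter. -/
  map : K → Plane → Plane
  vtx_injective : ∀ k, Function.Injective (vtx k)
  vtx_distinct : ∀ k l, range (vtx k) = range (vtx l) → k = l
  /-- Elements that share an edge order its two vertices in the same way (as holds whenever the local
  order is induced by a global order of the vertices). -/
  oriented : ∀ k l i j i' j', vtx k i = vtx l i' → vtx k j = vtx l j' → i < j → i' < j'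
  /-- Every element map is `C¹` up to the boundary. -/
  contDiff : ∀ k, ∃ O : Set Plane, IsOpen O ∧ refTriangle ⊆ O ∧ ContDiffOn ℝ 1 (map k) O
  /-- The Jacobian is invertible; its determinant may have either sign. -/
  det_ne_zero : ∀ k, ∀ ξ ∈ refTriangle, (fderiv ℝ (map k) ξ).det ≠ 0
  /-- Two points of elements coincide exactly if they have the same barycentric coordinates with
  respect to the global vertices. Hence each map is injective on `Γ`, and two elements meet in the
  vertex or edge spanned by their common vertices, if any, with the same parametrization. -/
  glue : ∀ k l, ∀ ξ ∈ refTriangle, ∀ ζ ∈ refTriangle,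
    map k ξ = map l ζ ↔
      ∑ i, Finsupp.single (vtx k i) (bary ξ i) = ∑ i, Finsupp.single (vtx l i) (bary ζ i)

/-- `A` is an open set that is meshed by `M`. -/
def Mesh.IsMeshOf {V K : Type*} (M : Mesh V K) (A : Set Plane) : Prop :=
  IsOpen A ∧ closure A = ⋃ k, M.map k '' refTriangle

/-- The contravariant Piola transformation `(1 / det J) J φ` at `ξ` for the map `x` with Jacobian
`J`; it is the value of the transformed field at the point `x ξ`. -/
noncomputable def piola (x : Plane → Plane) (φ : PolyField) (ξ : Plane) : Plane :=
  (1 / (fderiv ℝ x ξ).det) • fderiv ℝ x ξ (evalField φ ξ)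

/-- The global `RT^p` space: on each element, `u` is the Piola image of a combination of base
functions of `RT^p`. The coefficient `c a b m` of the `m`-th function of the edge from `a` to `b` is
shared by the elements that contain this edge; the cell part `w k` is free on every element. The
values of `u` on the (negligible) rest of the plane are arbitrary. -/
def rtSpace {V K : Type*} (M : Mesh V K) {p : ℕ} (U : 1 ≤ p → PolytopalBasis p)
    (U' : PolytopalBasis (p + 1)) : Set (Plane → Plane) :=
  {u | ∃ (c : V → V → Option (Fin p) → ℝ) (w : K → PolyField),
    (∀ k, w k ∈ rtCell U U') ∧
    ∀ k, ∀ ξ ∈ interior refTriangle,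
      u (M.map k ξ) = piola (M.map k)
        (∑ e, ∑ m, c (M.vtx k (edgeStart e)) (M.vtx k (edgeEnd e)) m • rtEdge U' e m + w k) ξ}

end RTTemplate

/-! Take $d=\operatorname{div}\phi_T/\det J_T$ on each element as the candidate for the weak
divergence. With $Q=q\circ x_T$, the Piola factor cancels the change of variables up to the sign of
$\det J_T$, so $\int_T (u\cdot\nabla q+d\,q)$ is this sign times the integral of $\phi_T\cdot\nabla
Q+Q\operatorname{div}\phi_T$ over `refTriangle`. By Green's formula (`green_refTriangle`,
`green_piola`) only edge integrals of `edgeFlux` times $q$ remain, and they have to cancel in the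
sum over all elements.

Algebra (`edgeFlux_combination`): the flux density through an edge depends only on the coefficients
shared at that edge. The lowest-order functions have flux 1 through their own edge and 0 through the
others. The flux of $R\nabla n$ is the derivative of the trace of $n$, so it is common to all edges
by $H^1$-conformity and zero where $n$ vanishes. Every template product loses its flux either
through the scalar factor or through the template.

Geometry (`sum_orient_eq_zero`): an edge with a relatively interior point in $A$ has exactly one
element on each side. Two on the same side would overlap (`eq_of_ends_eq_of_orient_eq`); with none
on some side, points of $A$ would be uncovered (`exists_orient_eq`). So the signs `orient` add up to
zero there, and outside $A$ the test function vanishes. The side of an element is read off the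
derivative, along a ray, of the barycentric coordinate that is zero on the edge. -/

namespace RTTemplate

/-! ### The reference triangle -/

lemma convex_refTriangle : Convex ℝ refTriangle := by
  rintro x ⟨⟨h1, h2⟩, ⟨h3, h4⟩, h5⟩ y ⟨⟨h1', h2'⟩, ⟨h3', h4'⟩, h5'⟩ a b ha hb hab
  have hb' : b = 1 - a := by linarith
  subst hb'
  refine ⟨⟨?_, ?_⟩, ⟨?_, ?_⟩, ?_⟩ <;> simp only [PiLp.add_apply, PiLp.smul_apply, smul_eq_mul] <;>
    nlinarith

lemma isClosed_refTriangle : IsClosed refTriangle := by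
  have h0 : Continuous fun ξ : Plane => ξ 0 := by fun_prop
  have h1 : Continuous fun ξ : Plane => ξ 1 := by fun_prop
  exact (isClosed_Icc.preimage h0).inter ((isClosed_Icc.preimage h1).inter
    (isClosed_le (h0.add h1) continuous_const))

lemma isCompact_refTriangle : IsCompact refTriangle := by
  refine Metric.isCompact_of_isClosed_isBounded isClosed_refTriangle ?_
  refine (Metric.isBounded_closedBall (x := (0 : Plane)) (r := 2)).subset ?_
  rintro x ⟨⟨h1, h2⟩, ⟨h3, h4⟩, h5⟩
  rw [mem_closedBall_zero_iff, EuclideanSpace.norm_eq, Real.sqrt_le_left (by norm_num)]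
  simp only [Fin.sum_univ_two, Real.norm_eq_abs, sq_abs]
  nlinarith

lemma mem_refTriangle_iff_bary {ξ : Plane} : ξ ∈ refTriangle ↔ ∀ i, 0 ≤ bary ξ i := by
  simp only [Fin.forall_fin_succ, bary, refTriangle, mem_ofPred_eq, mem_Icc]
  constructor
  · rintro ⟨⟨h1, h2⟩, ⟨h3, h4⟩, h5⟩
    refine ⟨?_, ?_, ?_, by simp⟩ <;> simp <;> linarith
  · rintro ⟨h1, h2, h3, -⟩
    simp at h1 h2 h3
    refine ⟨⟨?_, ?_⟩, ⟨?_, ?_⟩, ?_⟩ <;> linarith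

lemma continuous_bary (i : Fin 3) : Continuous fun ξ : Plane => bary ξ i := by
  fin_cases i <;> simp [bary] <;> fun_prop

lemma isOpen_setOf_bary_pos : IsOpen {ξ : Plane | ∀ i, 0 < bary ξ i} := by
  simp only [ofPred_forall]
  exact isOpen_iInter_of_finite fun i => isOpen_lt continuous_const (continuous_bary i)

lemma setOf_bary_pos_subset_interior : {ξ : Plane | ∀ i, 0 < bary ξ i} ⊆ interior refTriangle :=
  interior_maximal (fun _ h => mem_refTriangle_iff_bary.2 fun i => (h i).le) isOpen_setOf_bary_pos

lemma bary_affine (ξ ζ : Plane) (t : ℝ) (i : Fin 3) :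
    bary (ξ + t • (ζ - ξ)) i = bary ξ i + t * (bary ζ i - bary ξ i) := by
  fin_cases i <;> simp [bary]
  ring

/-- If the coordinate were zero, a small step directly away from the vertex `i` would make it
negative while staying in the triangle. -/
lemma bary_pos_of_mem_interior {ξ : Plane} (h : ξ ∈ interior refTriangle) (i : Fin 3) :
    0 < bary ξ i := by
  refine lt_of_le_of_ne (mem_refTriangle_iff_bary.1 (interior_subset h) i) fun h0 => ?_
  have hc : Filter.Tendsto (fun t : ℝ => ξ + t • (refVertex i - ξ)) (nhds 0) (nhds ξ) := by
    have : Continuous (fun t : ℝ => ξ + t • (refVertex i - ξ)) := by fun_prop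
    simpa using this.tendsto 0
  have hev := hc.eventually (isOpen_interior.mem_nhds h)
  obtain ⟨ε, hε, hb⟩ := Metric.eventually_nhds_iff.1 hev
  have h1 := hb (y := -(ε / 2)) (by simp [abs_of_pos hε, hε])
  have h2 := mem_refTriangle_iff_bary.1 (interior_subset h1) i
  rw [bary_affine, ← h0] at h2
  have : bary (refVertex i) i = 1 := by fin_cases i <;> simp [bary, refVertex]
  rw [this] at h2
  linarith

lemma mem_interior_refTriangle_iff {ξ : Plane} :
    ξ ∈ interior refTriangle ↔ ∀ i, 0 < bary ξ i :=
  ⟨bary_pos_of_mem_interior, fun h => setOf_bary_pos_subset_interior h⟩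

lemma interior_refTriangle_ae_eq : interior refTriangle =ᵐ[volume] refTriangle :=
  interior_ae_eq_of_null_frontier (convex_refTriangle.addHaar_frontier _)

/-! ### Iterated integrals over the triangle -/

/-- The identification of `ℝ × ℝ` with the plane. -/
noncomputable def planeEquiv : ℝ × ℝ ≃ᵐ Plane :=
  MeasurableEquiv.finTwoArrow.symm.trans (MeasurableEquiv.toLp 2 (Fin 2 → ℝ))

lemma measurePreserving_planeEquiv : MeasurePreserving planeEquiv volume volume :=
  (PiLp.volume_preserving_toLp (Fin 2)).comp (volume_preserving_finTwoArrow ℝ).symm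

lemma mem_refTriangle_mk {s t : ℝ} : !₂[s, t] ∈ refTriangle ↔ 0 ≤ s ∧ 0 ≤ t ∧ s + t ≤ 1 := by
  simp only [refTriangle, mem_ofPred_eq, mem_Icc]
  constructor
  · rintro ⟨⟨h1, h2⟩, ⟨h3, h4⟩, h5⟩
    exact ⟨h1, h3, h5⟩
  · rintro ⟨h1, h2, h3⟩
    simp at h1 h2 h3 ⊢
    refine ⟨⟨?_, ?_⟩, ⟨?_, ?_⟩, ?_⟩ <;> linarith

/-- The parametrization `φ` is left free so that both orders of integration are covered. -/
lemma integral_indicator_slice {g : Plane → ℝ} {φ : ℝ → ℝ → Plane}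
    (hφ : ∀ s t, φ s t ∈ refTriangle ↔ 0 ≤ s ∧ 0 ≤ t ∧ s + t ≤ 1) :
    ∫ t, ∫ s, refTriangle.indicator g (φ s t) =
      ∫ t in (0 : ℝ)..1, ∫ s in (0 : ℝ)..(1 - t), g (φ s t) := by
  rw [intervalIntegral.integral_of_le zero_le_one, ← integral_Icc_eq_integral_Ioc,
    ← integral_indicator measurableSet_Icc]
  congr 1
  ext t
  by_cases ht : t ∈ Icc (0 : ℝ) 1
  · rw [indicator_of_mem ht, intervalIntegral.integral_of_le (by linarith [ht.2]),
      ← integral_Icc_eq_integral_Ioc, ← integral_indicator measurableSet_Icc]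
    congr 1
    ext s
    by_cases hs : s ∈ Icc 0 (1 - t)
    · rw [indicator_of_mem hs, indicator_of_mem]
      exact (hφ s t).2 ⟨hs.1, ht.1, by linarith [hs.2]⟩
    · rw [indicator_of_notMem hs, indicator_of_notMem]
      exact fun h => hs ⟨((hφ s t).1 h).1, by linarith [((hφ s t).1 h).2.2]⟩
  · rw [indicator_of_notMem ht]
    have : (fun s => refTriangle.indicator g (φ s t)) = fun _ => 0 := by
      ext s
      rw [indicator_of_notMem]
      exact fun h => ht ⟨((hφ s t).1 h).2.1, by linarith [((hφ s t).1 h).2.2, ((hφ s t).1 h).1]⟩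
    rw [this, integral_zero]

lemma integrable_indicator_planeEquiv {g : Plane → ℝ} (hg : ContinuousOn g refTriangle) :
    Integrable (fun z => refTriangle.indicator g (planeEquiv z)) (volume.prod volume) := by
  have h := (hg.integrableOn_compact (μ := volume) isCompact_refTriangle).integrable_indicator
    isClosed_refTriangle.measurableSet
  exact (measurePreserving_planeEquiv.integrable_comp_emb planeEquiv.measurableEmbedding).2 h

lemma setIntegral_refTriangle_eq_prod (g : Plane → ℝ) :
    ∫ ξ in refTriangle, g ξ =
      ∫ z, refTriangle.indicator g (planeEquiv z) ∂(volume.prod volume) := by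
  rw [← integral_indicator isClosed_refTriangle.measurableSet]
  exact (measurePreserving_planeEquiv.integral_comp planeEquiv.measurableEmbedding _).symm

lemma setIntegral_refTriangle {g : Plane → ℝ} (hg : ContinuousOn g refTriangle) :
    ∫ ξ in refTriangle, g ξ = ∫ t in (0 : ℝ)..1, ∫ s in (0 : ℝ)..(1 - t), g !₂[s, t] := by
  rw [setIntegral_refTriangle_eq_prod, integral_prod_symm _ (integrable_indicator_planeEquiv hg)]
  exact integral_indicator_slice fun s t => mem_refTriangle_mk

lemma setIntegral_refTriangle' {g : Plane → ℝ} (hg : ContinuousOn g refTriangle) :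
    ∫ ξ in refTriangle, g ξ = ∫ t in (0 : ℝ)..1, ∫ s in (0 : ℝ)..(1 - t), g !₂[t, s] := by
  rw [setIntegral_refTriangle_eq_prod, integral_prod _ (integrable_indicator_planeEquiv hg)]
  exact integral_indicator_slice fun s t => mem_refTriangle_mk.trans (by rw [add_comm]; tauto)

/-! ### Green's formula -/

lemma hasDerivAt_comp_line {f : Plane → ℝ} {a v : Plane} {s : ℝ}
    (hf : DifferentiableAt ℝ f (a + s • v)) :
    HasDerivAt (fun r : ℝ => f (a + r • v)) (fderiv ℝ f (a + s • v) v) s := by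
  have h : HasDerivAt (fun r : ℝ => a + r • v) v s := by
    simpa using ((hasDerivAt_id s).smul_const v).const_add a
  exact hf.hasFDerivAt.comp_hasDerivAt s h

lemma integral_fderiv_line {f : Plane → ℝ} {O : Set Plane} (hO : IsOpen O)
    (hf : ContDiffOn ℝ 1 f O) {a v : Plane} {l : ℝ} (hl : 0 ≤ l)
    (hmem : ∀ s ∈ Icc 0 l, a + s • v ∈ O) :
    ∫ s in (0 : ℝ)..l, fderiv ℝ f (a + s • v) v = f (a + l • v) - f a := by
  have hint : IntervalIntegrable (fun s : ℝ => fderiv ℝ f (a + s • v) v) volume 0 l := by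
    refine ContinuousOn.intervalIntegrable ?_
    rw [uIcc_of_le hl]
    have h1 : ContinuousOn (fun s : ℝ => fderiv ℝ f (a + s • v)) (Icc 0 l) :=
      (hf.continuousOn_fderiv_of_isOpen hO le_rfl).comp (by fun_prop) hmem
    exact h1.clm_apply continuousOn_const
  rw [intervalIntegral.integral_eq_sub_of_hasDerivAt (f := fun s => f (a + s • v)) _ hint]
  · simp
  · intro s hs
    rw [uIcc_of_le hl] at hs
    exact hasDerivAt_comp_line ((hf.contDiffAt (hO.mem_nhds (hmem s hs))).differentiableAt
      one_ne_zero)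

lemma continuousOn_fderiv_apply {f : Plane → ℝ} {O : Set Plane} (hO : IsOpen O)
    (hf : ContDiffOn ℝ 1 f O) (hΓ : refTriangle ⊆ O) (v : Plane) :
    ContinuousOn (fun ξ => fderiv ℝ f ξ v) refTriangle :=
  ((hf.continuousOn_fderiv_of_isOpen hO le_rfl).mono hΓ).clm_apply continuousOn_const

lemma setIntegral_partial_zero {f : Plane → ℝ} {O : Set Plane} (hO : IsOpen O)
    (hf : ContDiffOn ℝ 1 f O) (hΓ : refTriangle ⊆ O) :
    ∫ ξ in refTriangle, fderiv ℝ f ξ !₂[1, 0] =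
      ∫ t in (0 : ℝ)..1, (f !₂[1 - t, t] - f !₂[0, t]) := by
  rw [setIntegral_refTriangle (continuousOn_fderiv_apply hO hf hΓ _)]
  refine intervalIntegral.integral_congr fun t ht => ?_
  rw [uIcc_of_le zero_le_one] at ht
  have e : ∀ s : ℝ, (!₂[s, t] : Plane) = !₂[0, t] + s • !₂[1, 0] := fun s => by
    ext i; fin_cases i <;> simp
  have := integral_fderiv_line hO hf (a := !₂[0, t]) (v := !₂[1, 0]) (l := 1 - t)
    (by linarith [ht.2]) (fun s hs => by
      rw [← e]; exact hΓ (mem_refTriangle_mk.2 ⟨hs.1, ht.1, by linarith [hs.2]⟩))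
  simp only [← e] at this
  exact this

lemma setIntegral_partial_one {f : Plane → ℝ} {O : Set Plane} (hO : IsOpen O)
    (hf : ContDiffOn ℝ 1 f O) (hΓ : refTriangle ⊆ O) :
    ∫ ξ in refTriangle, fderiv ℝ f ξ !₂[0, 1] =
      ∫ t in (0 : ℝ)..1, (f !₂[t, 1 - t] - f !₂[t, 0]) := by
  rw [setIntegral_refTriangle' (continuousOn_fderiv_apply hO hf hΓ _)]
  refine intervalIntegral.integral_congr fun t ht => ?_
  rw [uIcc_of_le zero_le_one] at ht
  have e : ∀ s : ℝ, (!₂[t, s] : Plane) = !₂[t, 0] + s • !₂[0, 1] := fun s => by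
    ext i; fin_cases i <;> simp
  have := integral_fderiv_line hO hf (a := !₂[t, 0]) (v := !₂[0, 1]) (l := 1 - t)
    (by linarith [ht.2]) (fun s hs => by
      rw [← e]; exact hΓ (mem_refTriangle_mk.2 ⟨ht.1, hs.1, by linarith [hs.2]⟩))
  simp only [← e] at this
  exact this

/-! ### Polynomial functions -/

lemma hasFDerivAt_evalPoly (n : Poly) (ξ : Plane) :
    HasFDerivAt (evalPoly n) (evalPoly (MvPolynomial.pderiv 0 n) ξ • EuclideanSpace.proj (𝕜 := ℝ) 0 +
      evalPoly (MvPolynomial.pderiv 1 n) ξ • EuclideanSpace.proj (𝕜 := ℝ) 1) ξ := by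
  induction n using MvPolynomial.induction_on with
  | C a =>
    have : evalPoly (MvPolynomial.C a) = fun _ => a := by ext; simp [evalPoly]
    rw [this]
    simpa [evalPoly] using hasFDerivAt_const a ξ
  | add f g hf hg =>
    have : evalPoly (f + g) = fun x => evalPoly f x + evalPoly g x := by ext; simp [evalPoly]
    rw [this]
    refine (hf.add hg).congr_fderiv ?_
    ext v
    simp [evalPoly]
    ring
  | mul_X f i hf =>
    have : evalPoly (f * MvPolynomial.X i) = fun x => evalPoly f x * x i := by ext; simp [evalPoly]
    rw [this]
    have hi : HasFDerivAt (fun x : Plane => x i) (EuclideanSpace.proj (𝕜 := ℝ) i) ξ :=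
      (EuclideanSpace.proj (𝕜 := ℝ) i).hasFDerivAt
    refine (hf.mul hi).congr_fderiv ?_
    ext v
    fin_cases i <;> simp [evalPoly, MvPolynomial.pderiv_X] <;> ring

lemma contDiff_evalPoly (n : Poly) : ContDiff ℝ 1 (evalPoly n) := by
  induction n using MvPolynomial.induction_on with
  | C a =>
    have : evalPoly (MvPolynomial.C a) = fun _ => a := by ext; simp [evalPoly]
    rw [this]; exact contDiff_const
  | add f g hf hg =>
    have : evalPoly (f + g) = fun x => evalPoly f x + evalPoly g x := by ext; simp [evalPoly]
    rw [this]; exact hf.add hg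
  | mul_X f i hf =>
    have : evalPoly (f * MvPolynomial.X i) = fun x => evalPoly f x * x i := by ext; simp [evalPoly]
    rw [this]; exact hf.mul (EuclideanSpace.proj (𝕜 := ℝ) i).contDiff

/-- The divergence of a polynomial vector field. -/
noncomputable def divPoly (φ : PolyField) : Poly :=
  MvPolynomial.pderiv 0 (φ 0) + MvPolynomial.pderiv 1 (φ 1)

/-- The tangent vector of an edge. -/
noncomputable def edgeTangent (e : Fin 3) : Plane := refVertex (edgeEnd e) - refVertex (edgeStart e)

/-- The flux density of `φ` through the edge `e`, in the direction obtained by rotating the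
tangent clockwise. -/
noncomputable def edgeFlux (e : Fin 3) (φ : PolyField) (t : ℝ) : ℝ :=
  evalPoly (φ 0) (edgePoint e t) * edgeTangent e 1 - evalPoly (φ 1) (edgePoint e t) * edgeTangent e 0

/-- The sign `1` if the triangle lies on the left of the edge `e`, and `-1` otherwise. -/
def edgeSign : Fin 3 → ℝ := ![-1, 1, -1]

lemma edgePoint_zero (t : ℝ) : edgePoint 0 t = !₂[0, t] := by
  ext i; fin_cases i <;> simp [edgePoint, edgeStart, edgeEnd, refVertex]

lemma edgePoint_one (t : ℝ) : edgePoint 1 t = !₂[t, 0] := by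
  ext i; fin_cases i <;> simp [edgePoint, edgeStart, edgeEnd, refVertex]

lemma edgePoint_two (t : ℝ) : edgePoint 2 t = !₂[t, 1 - t] := by
  ext i; fin_cases i <;> simp [edgePoint, edgeStart, edgeEnd, refVertex]

lemma edgePoint_mem {t : ℝ} (ht : t ∈ Icc (0 : ℝ) 1) (e : Fin 3) : edgePoint e t ∈ refTriangle := by
  have := ht.1
  have := ht.2
  fin_cases e
  · exact edgePoint_zero t ▸ mem_refTriangle_mk.2 ⟨by simp, by linarith, by linarith⟩
  · exact edgePoint_one t ▸ mem_refTriangle_mk.2 ⟨by linarith, by simp, by linarith⟩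
  · exact edgePoint_two t ▸ mem_refTriangle_mk.2 ⟨by linarith, by linarith, by linarith⟩

lemma continuous_edgePoint (e : Fin 3) : Continuous (edgePoint e) := by
  unfold edgePoint; fun_prop

lemma continuous_edgeFlux (e : Fin 3) (φ : PolyField) : Continuous (edgeFlux e φ) := by
  have h := fun i => (contDiff_evalPoly (φ i)).continuous.comp (continuous_edgePoint e)
  exact ((h 0).mul continuous_const).sub ((h 1).mul continuous_const)

/-- Green's formula on the reference triangle. -/
lemma green_refTriangle {Q : Plane → ℝ} {O : Set Plane} (hO : IsOpen O)
    (hQ : ContDiffOn ℝ 1 Q O) (hΓ : refTriangle ⊆ O) (φ : PolyField) :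
    ∫ ξ in refTriangle, (fderiv ℝ Q ξ (evalField φ ξ) + evalPoly (divPoly φ) ξ * Q ξ) =
      ∑ e, edgeSign e * ∫ t in (0 : ℝ)..1, edgeFlux e φ t * Q (edgePoint e t) := by
  have hF : ∀ i, ContDiffOn ℝ 1 (fun ξ => evalPoly (φ i) ξ * Q ξ) O := fun i =>
    (contDiff_evalPoly (φ i)).contDiffOn.mul hQ
  have hcont : ∀ i, ContinuousOn (fun ξ => evalPoly (φ i) ξ * Q ξ) refTriangle := fun i =>
    (hF i).continuousOn.mono hΓ
  have h0 := setIntegral_partial_zero hO (hF 0) hΓ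
  have h1 := setIntegral_partial_one hO (hF 1) hΓ
  -- The integrand is $\operatorname{div}(Q\phi)$; each partial derivative is integrated along its
  -- own axis.
  have key : ∀ ξ ∈ refTriangle, fderiv ℝ Q ξ (evalField φ ξ) + evalPoly (divPoly φ) ξ * Q ξ =
      fderiv ℝ (fun ξ => evalPoly (φ 0) ξ * Q ξ) ξ !₂[1, 0] +
      fderiv ℝ (fun ξ => evalPoly (φ 1) ξ * Q ξ) ξ !₂[0, 1] := by
    intro ξ hξ
    have hd : HasFDerivAt Q (fderiv ℝ Q ξ) ξ := ((hQ.contDiffAt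
      (hO.mem_nhds (hΓ hξ))).differentiableAt one_ne_zero).hasFDerivAt
    have e : evalField φ ξ = evalPoly (φ 0) ξ • !₂[1, 0] + evalPoly (φ 1) ξ • !₂[0, 1] := by
      ext i; fin_cases i <;> simp [evalField]
    rw [((hasFDerivAt_evalPoly (φ 0) ξ).fun_mul hd).fderiv, ((hasFDerivAt_evalPoly (φ 1) ξ).fun_mul hd).fderiv,
      e, map_add, map_smul, map_smul]
    simp [divPoly, evalPoly]
    ring
  rw [setIntegral_congr_fun isClosed_refTriangle.measurableSet key, integral_add, h0, h1]
  · have hii : ∀ (i : Fin 3) (j : Fin 2), IntervalIntegrable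
        (fun t => evalPoly (φ j) (edgePoint i t) * Q (edgePoint i t)) volume 0 1 := by
      intro i j
      refine ContinuousOn.intervalIntegrable ?_
      rw [uIcc_of_le zero_le_one]
      exact (hcont j).comp (continuous_edgePoint i).continuousOn fun t ht => edgePoint_mem ht i
    -- Horizontal slices run through the hypotenuse against the direction of `edgePoint 2`, hence
    -- the reflection $t\mapsto 1-t$.
    have hrefl : ∫ t in (0 : ℝ)..1, evalPoly (φ 0) !₂[1 - t, t] * Q !₂[1 - t, t] =
        ∫ t in (0 : ℝ)..1, evalPoly (φ 0) !₂[t, 1 - t] * Q !₂[t, 1 - t] := by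
      have := intervalIntegral.integral_comp_sub_left (a := 0) (b := 1)
        (fun t : ℝ => evalPoly (φ 0) !₂[t, 1 - t] * Q !₂[t, 1 - t]) 1
      simpa using this
    have hii2 : IntervalIntegrable (fun t : ℝ => evalPoly (φ 0) !₂[1 - t, t] * Q !₂[1 - t, t])
        volume 0 1 := by
      have := (hii 2 0).comp_sub_left 1
      simp only [edgePoint_two] at this
      simpa using this.symm
    have a0 := hii 0 0
    have a1 := hii 1 1
    have a20 := hii 2 0
    have a21 := hii 2 1
    simp only [edgePoint_zero] at a0
    simp only [edgePoint_one] at a1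
    simp only [edgePoint_two] at a20 a21
    rw [intervalIntegral.integral_sub hii2 a0, intervalIntegral.integral_sub a21 a1, hrefl]
    simp only [Fin.sum_univ_three, edgeSign, edgeFlux, edgeTangent, edgeStart, edgeEnd, refVertex,
      edgePoint_zero, edgePoint_one, edgePoint_two]
    simp only [Matrix.cons_val_zero, Matrix.cons_val_one, Matrix.cons_val, PiLp.sub_apply]
    simp only [sub_zero, mul_one, mul_zero, zero_sub, mul_neg, neg_mul, one_mul]
    have : ∀ t : ℝ, (-(evalPoly (φ 0) !₂[t, 1 - t]) - evalPoly (φ 1) !₂[t, 1 - t]) * Q !₂[t, 1 - t]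
      = -(evalPoly (φ 0) !₂[t, 1 - t] * Q !₂[t, 1 - t] + evalPoly (φ 1) !₂[t, 1 - t] * Q !₂[t, 1 - t]) := by
      intro t; ring
    simp only [this, intervalIntegral.integral_neg, intervalIntegral.integral_add a20 a21]
    ring
  · exact (continuousOn_fderiv_apply hO (hF 0) hΓ _).integrableOn_compact isCompact_refTriangle
  · exact (continuousOn_fderiv_apply hO (hF 1) hΓ _).integrableOn_compact isCompact_refTriangle

/-! ### Edge fluxes of the base functions -/

/-- The edge flux at a point as a linear functional. -/
noncomputable def edgeFluxHom (e : Fin 3) (t : ℝ) : PolyField →ₗ[ℝ] ℝ where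
  toFun φ := edgeFlux e φ t
  map_add' φ ψ := by simp [edgeFlux, evalPoly]; ring
  map_smul' c φ := by simp [edgeFlux, evalPoly, MvPolynomial.smul_eval]; ring

lemma edgeFlux_add (e : Fin 3) (φ ψ : PolyField) (t : ℝ) :
    edgeFlux e (φ + ψ) t = edgeFlux e φ t + edgeFlux e ψ t := (edgeFluxHom e t).map_add φ ψ

lemma edgeFlux_sub (e : Fin 3) (φ ψ : PolyField) (t : ℝ) :
    edgeFlux e (φ - ψ) t = edgeFlux e φ t - edgeFlux e ψ t := (edgeFluxHom e t).map_sub φ ψ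

lemma edgeFlux_neg (e : Fin 3) (φ : PolyField) (t : ℝ) :
    edgeFlux e (-φ) t = -edgeFlux e φ t := (edgeFluxHom e t).map_neg φ

lemma edgeFlux_smul (e : Fin 3) (c : ℝ) (φ : PolyField) (t : ℝ) :
    edgeFlux e (c • φ) t = c * edgeFlux e φ t := (edgeFluxHom e t).map_smul c φ

lemma edgeFlux_sum {ι : Type*} (e : Fin 3) (s : Finset ι) (φ : ι → PolyField) (t : ℝ) :
    edgeFlux e (∑ i ∈ s, φ i) t = ∑ i ∈ s, edgeFlux e (φ i) t := map_sum (edgeFluxHom e t) φ s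

lemma edgeFlux_poly_smul (e : Fin 3) (n : Poly) (φ : PolyField) (t : ℝ) :
    edgeFlux e (n • φ) t = evalPoly n (edgePoint e t) * edgeFlux e φ t := by
  simp [edgeFlux, evalPoly]; ring

/-- The directions of the edges, from first to second vertex, are what makes all three fluxes $+1$.
-/
lemma edgeFlux_rtLowest (e e' : Fin 3) (t : ℝ) :
    edgeFlux e (rtLowest e') t = if e = e' then 1 else 0 := by
  fin_cases e <;> fin_cases e' <;>
    simp [edgeFlux, edgeTangent, edgeStart, edgeEnd, refVertex, evalPoly, rtLowest, edgePoint]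

lemma hasDerivAt_edgePoint (e : Fin 3) (t : ℝ) : HasDerivAt (edgePoint e) (edgeTangent e) t := by
  have h1 : HasDerivAt (fun s : ℝ => refVertex (edgeStart e) + s • edgeTangent e)
      (edgeTangent e) t := by
    simpa using ((hasDerivAt_id t).smul_const (edgeTangent e)).const_add
      (refVertex (edgeStart e))
  convert h1 using 1
  ext1 s
  simp only [edgePoint, edgeTangent]
  module

/-- Gradient and tangent are both rotated by a right angle, so the flux of `rotGrad n` is $\nabla n$
against the tangent. Conditions on traces thereby become conditions on fluxes. -/
lemma hasDerivAt_evalPoly_edgePoint (n : Poly) (e : Fin 3) (t : ℝ) :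
    HasDerivAt (fun s => evalPoly n (edgePoint e s)) (edgeFlux e (rotGrad n) t) t := by
  refine ((hasFDerivAt_evalPoly n (edgePoint e t)).comp_hasDerivAt t
    (hasDerivAt_edgePoint e t)).congr_deriv ?_
  simp [edgeFlux, rotGrad, evalPoly]
  ring

/-- The traces are compared on $[0,1]$ only, so their two-sided derivatives are compared at interior
parameters. -/
lemma edgeFlux_rotGrad_congr {n n' : Poly} {e e' : Fin 3}
    (h : ∀ t ∈ Icc (0 : ℝ) 1, evalPoly n (edgePoint e t) = evalPoly n' (edgePoint e' t))
    {t : ℝ} (ht : t ∈ Ioo (0 : ℝ) 1) :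
    edgeFlux e (rotGrad n) t = edgeFlux e' (rotGrad n') t := by
  refine (hasDerivAt_evalPoly_edgePoint n e t).unique
    ((hasDerivAt_evalPoly_edgePoint n' e' t).congr_of_eventuallyEq ?_)
  filter_upwards [Icc_mem_nhds ht.1 ht.2] with s hs using h s hs

lemma edgeFlux_rotGrad_of_vanishes {n : Poly} {e : Fin 3} (h : VanishesOnEdge n e)
    {t : ℝ} (ht : t ∈ Ioo (0 : ℝ) 1) : edgeFlux e (rotGrad n) t = 0 := by
  rw [edgeFlux_rotGrad_congr (n' := 0) (e' := e) (fun s hs => (h s hs).trans (by simp [evalPoly])) ht]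
  simp [edgeFlux, rotGrad, evalPoly]

lemma edgeFlux_templateProducts {p : ℕ} {U : PolytopalBasis p} {φ : PolyField}
    (hφ : φ ∈ templateProducts U) (e : Fin 3) {t : ℝ} (ht : t ∈ Icc (0 : ℝ) 1) :
    edgeFlux e φ t = 0 := by
  rcases hφ with (⟨i, rfl⟩ | ⟨e', k, rfl⟩) | ⟨k, rfl⟩
  · rw [edgeFlux_poly_smul]
    have h := fun h1 h2 => U.vertex_vanishes i.castSucc e h1 h2 t ht
    -- A vertex template has flux only through the edge opposite to its vertex, and there the vertex
    -- function is zero.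
    fin_cases i <;> fin_cases e <;>
      first
        | (simp [vertexTemplate, edgeFlux_neg, edgeFlux_rtLowest]; done)
        | (rw [h (by decide) (by decide), zero_mul])
  · rw [edgeFlux_poly_smul]
    by_cases he : e = e'
    · subst he
      fin_cases e <;> simp [edgeTemplate, edgeFlux_sub, edgeFlux_neg, edgeFlux_rtLowest]
    · rw [U.edge_vanishes e' k e he t ht, zero_mul]
  · rw [edgeFlux_poly_smul, U.cell_vanishes k e t ht, zero_mul]

lemma edgeFlux_rtCell {p : ℕ} {U : 1 ≤ p → PolytopalBasis p} {U' : PolytopalBasis (p + 1)}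
    {w : PolyField} (hw : w ∈ rtCell U U') (e : Fin 3) {t : ℝ} (ht : t ∈ Ioo (0 : ℝ) 1) :
    edgeFlux e w t = 0 := by
  have : rtCell U U' ≤ LinearMap.ker (edgeFluxHom e t) := by
    refine Submodule.span_le.2 ?_
    rintro φ (⟨hp, hφ⟩ | ⟨k, rfl⟩)
    · exact edgeFlux_templateProducts hφ e (Ioo_subset_Icc_self ht)
    · exact edgeFlux_rotGrad_of_vanishes (U'.cell_vanishes k e) ht
  exact this hw

/-- The common flux density, on the edge of reference, of the `m`-th base functions of the edges. -/
noncomputable def edgeTrace {p : ℕ} (U' : PolytopalBasis (p + 1)) (m : Option (Fin p)) (t : ℝ) : ℝ :=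
  edgeFlux 0 (rtEdge U' 0 m) t

lemma edgeFlux_rtEdge {p : ℕ} {U' : PolytopalBasis (p + 1)} (hU' : U'.EdgeConforming)
    (e e' : Fin 3) (m : Option (Fin p)) {t : ℝ} (ht : t ∈ Ioo (0 : ℝ) 1) :
    edgeFlux e (rtEdge U' e' m) t = if e = e' then edgeTrace U' m t else 0 := by
  cases m with
  | none => simp [rtEdge, edgeTrace, edgeFlux_rtLowest]
  | some k =>
    split_ifs with h
    · subst h
      exact edgeFlux_rotGrad_congr (hU' k e 0) ht
    · exact edgeFlux_rotGrad_of_vanishes (U'.edge_vanishes e' k e h) ht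

lemma edgeFlux_combination {p : ℕ} {U : 1 ≤ p → PolytopalBasis p} {U' : PolytopalBasis (p + 1)}
    (hU' : U'.EdgeConforming) (c : Fin 3 → Option (Fin p) → ℝ) {w : PolyField}
    (hw : w ∈ rtCell U U') (e : Fin 3) {t : ℝ} (ht : t ∈ Ioo (0 : ℝ) 1) :
    edgeFlux e (∑ e', ∑ m, c e' m • rtEdge U' e' m + w) t = ∑ m, c e m * edgeTrace U' m t := by
  simp only [edgeFlux_add, edgeFlux_sum, edgeFlux_smul, edgeFlux_rtCell hw e ht,
    edgeFlux_rtEdge hU' e _ _ ht, add_zero]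
  rw [Finset.sum_eq_single e (fun e' _ h => by simp [h.symm]) (by simp)]
  simp

/-! ### Element maps -/

lemma sum_single_apply_of_injective {V : Type*} {f : Fin 3 → V} (hf : Function.Injective f)
    (b : Fin 3 → ℝ) (i : Fin 3) : (∑ j, Finsupp.single (f j) (b j)) (f i) = b i := by
  classical
  simp [Finsupp.single_apply, hf.eq_iff]

lemma exists_of_sum_single_apply_ne_zero {V : Type*} {f : Fin 3 → V} {b : Fin 3 → ℝ} {v : V}
    (h : (∑ j, Finsupp.single (f j) (b j)) v ≠ 0) : ∃ j, f j = v ∧ b j ≠ 0 := by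
  classical
  rw [Finsupp.finsetSum_apply] at h
  obtain ⟨j, -, hj⟩ := Finset.exists_ne_zero_of_sum_ne_zero h
  rw [Finsupp.single_apply] at hj
  split_ifs at hj with hv
  · exact ⟨j, hv, hj⟩
  · exact absurd rfl hj

lemma bary_injective : Function.Injective bary := by
  intro ξ ζ h
  ext i
  fin_cases i
  · simpa [bary] using congrFun h 2
  · simpa [bary] using congrFun h 1

namespace Mesh

variable {V K : Type*} (M : Mesh V K)

lemma contDiffAt (k : K) {ξ : Plane} (hξ : ξ ∈ refTriangle) : ContDiffAt ℝ 1 (M.map k) ξ := by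
  obtain ⟨O, hO, hΓ, h⟩ := M.contDiff k
  exact h.contDiffAt (hO.mem_nhds (hΓ hξ))

lemma hasFDerivAt (k : K) {ξ : Plane} (hξ : ξ ∈ refTriangle) :
    HasFDerivAt (M.map k) (fderiv ℝ (M.map k) ξ) ξ :=
  ((M.contDiffAt k hξ).differentiableAt one_ne_zero).hasFDerivAt

lemma continuousOn_map (k : K) : ContinuousOn (M.map k) refTriangle := fun _ hξ =>
  (M.contDiffAt k hξ).continuousAt.continuousWithinAt

lemma continuousOn_fderiv (k : K) : ContinuousOn (fderiv ℝ (M.map k)) refTriangle := by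
  obtain ⟨O, hO, hΓ, h⟩ := M.contDiff k
  exact (h.continuousOn_fderiv_of_isOpen hO le_rfl).mono hΓ

lemma continuousOn_det (k : K) : ContinuousOn (fun ξ => (fderiv ℝ (M.map k) ξ).det) refTriangle :=
  ContinuousLinearMap.continuous_det.comp_continuousOn (M.continuousOn_fderiv k)

lemma injOn_map (k : K) : InjOn (M.map k) refTriangle := by
  intro ξ hξ ζ hζ h
  have h' := (M.glue k k ξ hξ ζ hζ).1 h
  refine bary_injective (funext fun i => ?_)
  rw [← sum_single_apply_of_injective (M.vtx_injective k) (bary ξ), h',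
    sum_single_apply_of_injective (M.vtx_injective k)]

/-- By `glue`, a vertex with nonzero weight at a point is a vertex of every element containing that
point. -/
lemma exists_vtx_eq {k l : K} {ξ ζ : Plane} (hξ : ξ ∈ refTriangle) (hζ : ζ ∈ refTriangle)
    (h : M.map k ξ = M.map l ζ) {i : Fin 3} (hi : bary ξ i ≠ 0) :
    ∃ j, M.vtx l j = M.vtx k i ∧ bary ζ j = bary ξ i := by
  have h' := (M.glue k l ξ hξ ζ hζ).1 h
  have h1 := sum_single_apply_of_injective (M.vtx_injective k) (bary ξ) i
  rw [h'] at h1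
  obtain ⟨j, hj, -⟩ := exists_of_sum_single_apply_ne_zero (h1 ▸ hi)
  refine ⟨j, hj, ?_⟩
  rw [← h1, ← hj, sum_single_apply_of_injective (M.vtx_injective l)]

/-- At an interior point all three weights are nonzero, so both elements have the same vertex set.
-/
lemma eq_of_map_interior_eq {k l : K} {ξ ζ : Plane} (hξ : ξ ∈ interior refTriangle)
    (hζ : ζ ∈ interior refTriangle) (h : M.map k ξ = M.map l ζ) : k = l := by
  refine M.vtx_distinct k l (Subset.antisymm ?_ ?_)
  · rintro _ ⟨i, rfl⟩
    obtain ⟨j, hj, -⟩ := M.exists_vtx_eq (interior_subset hξ) (interior_subset hζ) h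
      (bary_pos_of_mem_interior hξ i).ne'
    exact ⟨j, hj⟩
  · rintro _ ⟨i, rfl⟩
    obtain ⟨j, hj, -⟩ := M.exists_vtx_eq (interior_subset hζ) (interior_subset hξ) h.symm
      (bary_pos_of_mem_interior hζ i).ne'
    exact ⟨j, hj⟩

/-- A function on the plane with prescribed values on the interiors of the elements. -/
lemma exists_eq_on_interiors {E : Type*} [Zero E] (g : K → Plane → E) :
    ∃ f : Plane → E, ∀ k, ∀ ξ ∈ interior refTriangle, f (M.map k ξ) = g k ξ := by
  classical
  refine ⟨fun y => if h : ∃ z : K × Plane, z.2 ∈ interior refTriangle ∧ M.map z.1 z.2 = y then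
    g h.choose.1 h.choose.2 else 0, fun k ξ hξ => ?_⟩
  have h : ∃ z : K × Plane, z.2 ∈ interior refTriangle ∧ M.map z.1 z.2 = M.map k ξ :=
    ⟨(k, ξ), hξ, rfl⟩
  have hk : h.choose.1 = k := M.eq_of_map_interior_eq h.choose_spec.1 hξ h.choose_spec.2
  have hx : h.choose.2 = ξ := by
    refine M.injOn_map k (interior_subset h.choose_spec.1) (interior_subset hξ) ?_
    have h2 := h.choose_spec.2
    rwa [hk] at h2
  beta_reduce
  rw [dif_pos h, hk, hx]

lemma isClosed_image (k : K) : IsClosed (M.map k '' refTriangle) :=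
  (isCompact_refTriangle.image_of_continuousOn (M.continuousOn_map k)).isClosed

/-! ### Integration over the elements -/

lemma hasFDerivWithinAt_interior (k : K) : ∀ ξ ∈ interior refTriangle,
    HasFDerivWithinAt (M.map k) (fderiv ℝ (M.map k) ξ) (interior refTriangle) ξ :=
  fun _ hξ => (M.hasFDerivAt k (interior_subset hξ)).hasFDerivWithinAt

lemma measurableSet_image_interior (k : K) :
    MeasurableSet (M.map k '' interior refTriangle) :=
  measurable_image_of_fderivWithin isOpen_interior.measurableSet (M.hasFDerivWithinAt_interior k)
    ((M.injOn_map k).mono interior_subset)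

lemma pairwise_disjoint_image_interior :
    Pairwise (Function.onFun Disjoint fun k => M.map k '' interior refTriangle) := by
  intro k l hkl
  refine Set.disjoint_left.2 ?_
  rintro _ ⟨ξ, hξ, rfl⟩ ⟨ζ, hζ, h⟩
  exact hkl (M.eq_of_map_interior_eq hξ hζ h.symm)

/-- The boundary of the triangle is a null set, and differentiable maps send null sets to null sets.
-/
lemma closure_ae_eq [Finite K] {A : Set Plane} (hA : M.IsMeshOf A) :
    (⋃ k, M.map k '' interior refTriangle : Set Plane) =ᵐ[volume] closure A := by
  rw [hA.2]
  refine Filter.EventuallyEq.countable_iUnion fun k => ?_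
  refine (image_mono interior_subset).eventuallyLE.antisymm ?_
  rw [ae_le_set]
  refine measure_mono_null (t := M.map k '' (refTriangle \ interior refTriangle)) ?_ ?_
  · rintro _ ⟨⟨ξ, hξ, rfl⟩, hn⟩
    exact ⟨ξ, ⟨hξ, fun h => hn ⟨ξ, h, rfl⟩⟩, rfl⟩
  · refine addHaar_image_eq_zero_of_differentiableOn_of_addHaar_eq_zero _
      (fun ξ hξ => (M.hasFDerivAt k hξ.1).differentiableAt.differentiableWithinAt) ?_
    exact ae_le_set.1 interior_refTriangle_ae_eq.symm.le

variable {E : Type*} [NormedAddCommGroup E] [NormedSpace ℝ E]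

lemma integrableOn_image_interior (k : K) {f g : Plane → E} (hg : ContinuousOn g refTriangle)
    (hfg : ∀ ξ ∈ interior refTriangle, f (M.map k ξ) = g ξ) :
    IntegrableOn f (M.map k '' interior refTriangle) := by
  rw [integrableOn_image_iff_integrableOn_abs_det_fderiv_smul volume isOpen_interior.measurableSet
    (M.hasFDerivWithinAt_interior k) ((M.injOn_map k).mono interior_subset)]
  have h : IntegrableOn (fun ξ => |(fderiv ℝ (M.map k) ξ).det| • g ξ) refTriangle :=
    ((M.continuousOn_det k).abs.smul hg).integrableOn_compact isCompact_refTriangle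
  exact (h.mono_set interior_subset).congr_fun (fun ξ hξ => by simp only [hfg ξ hξ])
    isOpen_interior.measurableSet

lemma integrableOn_closure [Finite K] {A : Set Plane} (hA : M.IsMeshOf A) {f : Plane → E}
    {g : K → Plane → E} (hg : ∀ k, ContinuousOn (g k) refTriangle)
    (hfg : ∀ k, ∀ ξ ∈ interior refTriangle, f (M.map k ξ) = g k ξ) :
    IntegrableOn f (closure A) := by
  rw [← integrableOn_congr_set_ae (M.closure_ae_eq hA), integrableOn_finite_iUnion]
  exact fun k => M.integrableOn_image_interior k (hg k) (hfg k)

lemma memLp_two [Finite K] {A : Set Plane} (hA : M.IsMeshOf A) {f : Plane → E}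
    {g : K → Plane → E} (hg : ∀ k, ContinuousOn (g k) refTriangle)
    (hfg : ∀ k, ∀ ξ ∈ interior refTriangle, f (M.map k ξ) = g k ξ) :
    MemLp f 2 (volume.restrict A) := by
  have h1 := (M.integrableOn_closure hA hg hfg).mono_set subset_closure
  rw [memLp_two_iff_integrable_sq_norm h1.aestronglyMeasurable]
  exact (M.integrableOn_closure hA (f := fun y => ‖f y‖ ^ 2) (g := fun k ξ => ‖g k ξ‖ ^ 2)
    (fun k => (hg k).norm.pow 2) (fun k ξ hξ => by rw [hfg k ξ hξ])).mono_set subset_closure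

lemma setIntegral_eq_sum [Fintype K] {A : Set Plane} (hA : M.IsMeshOf A) {f : Plane → E}
    {g : K → Plane → E} (hg : ∀ k, ContinuousOn (g k) refTriangle)
    (hfg : ∀ k, ∀ ξ ∈ interior refTriangle, f (M.map k ξ) = g k ξ) (hf : ∀ y ∉ A, f y = 0) :
    ∫ y in A, f y = ∑ k, ∫ ξ in refTriangle, |(fderiv ℝ (M.map k) ξ).det| • g k ξ := by
  -- As `f` vanishes off `A`, the domain can be enlarged to the closure without knowing that the
  -- frontier of `A` is null.
  rw [setIntegral_eq_integral_of_forall_compl_eq_zero hf,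
    ← setIntegral_eq_integral_of_forall_compl_eq_zero (s := closure A)
      (fun y hy => hf y fun h => hy (subset_closure h)),
    ← setIntegral_congr_set (M.closure_ae_eq hA), integral_iUnion_fintype
      M.measurableSet_image_interior M.pairwise_disjoint_image_interior
      (fun k => M.integrableOn_image_interior k (hg k) (hfg k))]
  refine Finset.sum_congr rfl fun k _ => ?_
  rw [integral_image_eq_integral_abs_det_fderiv_smul volume isOpen_interior.measurableSet
    (M.hasFDerivWithinAt_interior k) ((M.injOn_map k).mono interior_subset),
    ← setIntegral_congr_set interior_refTriangle_ae_eq]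
  exact setIntegral_congr_fun isOpen_interior.measurableSet fun ξ hξ => by simp only [hfg k ξ hξ]

end Mesh

open Filter Topology

/-! ### Plane determinants and barycentric coordinates near an edge -/

/-- The determinant of two plane vectors. -/
def det2 (a b : Plane) : ℝ := a 0 * b 1 - a 1 * b 0

lemma det2_map (J : Plane →L[ℝ] Plane) (a b : Plane) : det2 (J a) (J b) = J.det * det2 a b := by
  have hdet : J.det = det2 (J !₂[1, 0]) (J !₂[0, 1]) := by
    rw [ContinuousLinearMap.det, ← LinearMap.det_toMatrix (EuclideanSpace.basisFun (Fin 2) ℝ).toBasis,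
      Matrix.det_fin_two]
    have h0 : EuclideanSpace.single (0 : Fin 2) (1 : ℝ) = !₂[1, 0] := by
      ext i; fin_cases i <;> simp
    have h1 : EuclideanSpace.single (1 : Fin 2) (1 : ℝ) = !₂[0, 1] := by
      ext i; fin_cases i <;> simp
    simp only [LinearMap.toMatrix_apply, OrthonormalBasis.coe_toBasis, EuclideanSpace.basisFun_apply,
      OrthonormalBasis.coe_toBasis_repr_apply, EuclideanSpace.basisFun_repr, h0, h1, det2,
      ContinuousLinearMap.coe_coe]
    ring
  have e : ∀ v : Plane, v = v 0 • !₂[1, 0] + v 1 • !₂[0, 1] := fun v => by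
    ext i; fin_cases i <;> simp
  rw [hdet, e a, e b]
  simp only [map_add, map_smul, det2, PiLp.add_apply, PiLp.smul_apply, smul_eq_mul]
  simp
  ring

/-- The vertex that is not on the edge. -/
def oppVertex : Fin 3 → Fin 3 := ![2, 1, 0]

lemma bary_edgePoint_start (e : Fin 3) (t : ℝ) : bary (edgePoint e t) (edgeStart e) = 1 - t := by
  fin_cases e <;> simp [bary, edgePoint, edgeStart, edgeEnd, refVertex]

lemma bary_edgePoint_end (e : Fin 3) (t : ℝ) : bary (edgePoint e t) (edgeEnd e) = t := by
  fin_cases e <;> simp [bary, edgePoint, edgeStart, edgeEnd, refVertex]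

lemma bary_edgePoint_opp (e : Fin 3) (t : ℝ) : bary (edgePoint e t) (oppVertex e) = 0 := by
  fin_cases e <;> simp [bary, edgePoint, edgeStart, edgeEnd, refVertex, oppVertex]

lemma bary_edgePoint_pos {e i : Fin 3} (hi : i ≠ oppVertex e) {t : ℝ} (ht : t ∈ Ioo (0 : ℝ) 1) :
    0 < bary (edgePoint e t) i := by
  have h : i = edgeStart e ∨ i = edgeEnd e := by revert e i; decide
  rcases h with rfl | rfl
  · rw [bary_edgePoint_start]; linarith [ht.2]
  · rw [bary_edgePoint_end]; exact ht.1

/-- This coordinate is affine and constant along the edge, so its linear part is a multiple of the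
signed area against the tangent. -/
lemma bary_opp_eq (e : Fin 3) (ξ : Plane) :
    bary ξ (oppVertex e) = bary 0 (oppVertex e) + edgeSign e * det2 (edgeTangent e) ξ := by
  fin_cases e <;>
    simp [bary, oppVertex, edgeSign, det2, edgeTangent, edgeStart, edgeEnd, refVertex]
  ring

/-- The determinant against a fixed vector as a continuous linear functional. -/
noncomputable def det2Hom (a : Plane) : Plane →L[ℝ] ℝ :=
  a 0 • EuclideanSpace.proj (𝕜 := ℝ) 1 - a 1 • EuclideanSpace.proj (𝕜 := ℝ) 0

lemma det2Hom_apply (a b : Plane) : det2Hom a b = det2 a b := by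
  simp [det2Hom, det2]

lemma tendsto_ray (x w : Plane) : Tendsto (fun s : ℝ => x + s • w) (𝓝 0) (𝓝 x) := by
  have : Continuous (fun s : ℝ => x + s • w) := by fun_prop
  simpa using this.tendsto 0

namespace Mesh

variable {V K : Type*} (M : Mesh V K)

/-- The tangent vector at a point of the image of an edge. -/
noncomputable def tangent (k : K) (e : Fin 3) (t : ℝ) : Plane :=
  fderiv ℝ (M.map k) (edgePoint e t) (edgeTangent e)

/-- A local inverse of an element map at a point of an edge, with the derivative at `0` of the
barycentric coordinate that vanishes on the edge, along the preimage of a ray. -/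
lemma exists_local_inverse (k : K) (e : Fin 3) {t : ℝ} (ht : t ∈ Icc (0 : ℝ) 1) (w : Plane) :
    ∃ G : Plane → Plane, G (M.map k (edgePoint e t)) = edgePoint e t ∧
      ContinuousAt G (M.map k (edgePoint e t)) ∧
      (∀ᶠ y in 𝓝 (M.map k (edgePoint e t)), M.map k (G y) = y) ∧
      (∀ᶠ ξ in 𝓝 (edgePoint e t), G (M.map k ξ) = ξ) ∧
      HasDerivAt (fun s : ℝ => bary (G (M.map k (edgePoint e t) + s • w)) (oppVertex e))
        (edgeSign e * det2 (M.tangent k e t) w / (fderiv ℝ (M.map k) (edgePoint e t)).det) 0 := by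
  set ξ₀ := edgePoint e t with hξ₀
  have hmem : ξ₀ ∈ refTriangle := edgePoint_mem ht e
  have hdet := M.det_ne_zero k ξ₀ hmem
  set J := fderiv ℝ (M.map k) ξ₀ with hJ
  have hstrict : HasStrictFDerivAt (M.map k)
      ((J.toContinuousLinearEquivOfDetNeZero hdet : Plane ≃L[ℝ] Plane) : Plane →L[ℝ] Plane) ξ₀ :=
    (M.contDiffAt k hmem).hasStrictFDerivAt one_ne_zero
  refine ⟨hstrict.localInverse _ _ _, hstrict.localInverse_apply_image,
    hstrict.localInverse_continuousAt, hstrict.eventually_right_inverse,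
    hstrict.eventually_left_inverse, ?_⟩
  set D := J.toContinuousLinearEquivOfDetNeZero hdet
  set G := hstrict.localInverse _ _ _
  have hG : HasFDerivAt G (D.symm : Plane →L[ℝ] Plane) (M.map k ξ₀ + (0 : ℝ) • w) := by
    simpa using hstrict.to_localInverse.hasFDerivAt
  have hline : HasDerivAt (fun s : ℝ => M.map k ξ₀ + s • w) w 0 := by
    simpa using ((hasDerivAt_id (0 : ℝ)).smul_const w).const_add (M.map k ξ₀)
  have h1 := hG.comp_hasDerivAt (0 : ℝ) hline
  have h2 := ((det2Hom (edgeTangent e)).hasFDerivAt.comp_hasDerivAt (0 : ℝ) h1).const_mul (edgeSign e)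
  have h3 := h2.const_add (bary 0 (oppVertex e))
  -- Pulling `w` back by the inverse Jacobian divides the signed area against the tangent by the
  -- determinant.
  have hval : edgeSign e * det2 (M.tangent k e t) w / J.det =
      edgeSign e * det2Hom (edgeTangent e) (D.symm w) := by
    have : det2 (M.tangent k e t) w = J.det * det2 (edgeTangent e) (D.symm w) := by
      rw [← det2_map]
      congr 1
      exact (D.apply_symm_apply w).symm
    rw [this, det2Hom_apply]
    field_simp
  rw [hval]
  refine h3.congr_of_eventuallyEq (Eventually.of_forall fun s => ?_)
  simp only [bary_opp_eq e (G _), Function.comp_apply, det2Hom_apply]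

/-- Along the pulled-back ray the coordinate opposite to the edge leaves zero with positive slope;
the other two stay positive by continuity. -/
lemma eventually_mem_image_interior (k : K) (e : Fin 3) {t : ℝ} (ht : t ∈ Ioo (0 : ℝ) 1) {w : Plane}
    (hw : 0 < edgeSign e * det2 (M.tangent k e t) w / (fderiv ℝ (M.map k) (edgePoint e t)).det) :
    ∀ᶠ s in 𝓝[>] (0 : ℝ), M.map k (edgePoint e t) + s • w ∈ M.map k '' interior refTriangle := by
  obtain ⟨G, hG0, hGc, hGr, -, hder⟩ := M.exists_local_inverse k e (Ioo_subset_Icc_self ht) w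
  have hray := tendsto_ray (M.map k (edgePoint e t)) w
  have h1 := eventually_nhdsWithin_sign_eq_of_deriv_pos (by rwa [hder.deriv])
    (by simp [hG0, bary_edgePoint_opp])
  have h2 : ∀ i, i ≠ oppVertex e →
      ∀ᶠ s in 𝓝 (0 : ℝ), 0 < bary (G (M.map k (edgePoint e t) + s • w)) i := by
    intro i hi
    have hc : Tendsto (fun y => bary (G y) i) (𝓝 (M.map k (edgePoint e t)))
        (𝓝 (bary (edgePoint e t) i)) := by
      have := ((continuous_bary i).tendsto (G (M.map k (edgePoint e t)))).comp hGc.tendsto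
      rw [hG0] at this
      exact this
    exact (hc.comp hray).eventually (lt_mem_nhds (bary_edgePoint_pos hi ht))
  have h3 : ∀ᶠ s in 𝓝 (0 : ℝ), ∀ i, i ≠ oppVertex e →
      0 < bary (G (M.map k (edgePoint e t) + s • w)) i := by
    rw [eventually_all]
    intro i
    by_cases hi : i = oppVertex e
    · simp [hi]
    · filter_upwards [h2 i hi] with s hs _ using hs
  filter_upwards [h1.filter_mono nhdsWithin_le_nhds, h3.filter_mono nhdsWithin_le_nhds,
    (hray.eventually hGr).filter_mono nhdsWithin_le_nhds, self_mem_nhdsWithin] with s hs1 hs3 hs4 hs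
  refine ⟨_, mem_interior_refTriangle_iff.2 fun i => ?_, hs4⟩
  by_cases hi : i = oppVertex e
  · rw [sub_zero, sign_pos (mem_Ioi.1 hs), sign_eq_one_iff] at hs1
    exact hi ▸ hs1
  · exact hs3 i hi

/-- Injectivity and compactness make the inverse of the element map continuous on the image. This
excludes preimages far from `ξ₀`, which a local inverse cannot see. -/
lemma eventually_preimage_mem (k : K) {ξ₀ : Plane} (hξ₀ : ξ₀ ∈ refTriangle) {U : Set Plane}
    (hU : U ∈ 𝓝 ξ₀) : ∀ᶠ y in 𝓝 (M.map k ξ₀), ∀ ξ ∈ refTriangle, M.map k ξ = y → ξ ∈ U := by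
  have hc : IsClosed (M.map k '' (refTriangle \ interior U)) :=
    ((isCompact_refTriangle.diff isOpen_interior).image_of_continuousOn
      ((M.continuousOn_map k).mono sdiff_subset)).isClosed
  have hn : M.map k ξ₀ ∉ M.map k '' (refTriangle \ interior U) := by
    rintro ⟨ξ, ⟨hξ, hξU⟩, h⟩
    exact hξU (M.injOn_map k hξ hξ₀ h ▸ mem_interior_iff_mem_nhds.2 hU)
  filter_upwards [hc.isOpen_compl.mem_nhds hn] with y hy ξ hξ h
  by_contra hξU
  exact hy ⟨ξ, ⟨hξ, fun h' => hξU (interior_subset h')⟩, h⟩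

/-- A preimage in the triangle would have to be the one given by the local inverse, and that one has
a negative coordinate. -/
lemma eventually_notMem_image (k : K) (e : Fin 3) {t : ℝ} (ht : t ∈ Icc (0 : ℝ) 1) {w : Plane}
    (hw : edgeSign e * det2 (M.tangent k e t) w / (fderiv ℝ (M.map k) (edgePoint e t)).det < 0) :
    ∀ᶠ s in 𝓝[>] (0 : ℝ), M.map k (edgePoint e t) + s • w ∉ M.map k '' refTriangle := by
  obtain ⟨G, hG0, -, -, hGl, hder⟩ := M.exists_local_inverse k e ht w
  have hray := tendsto_ray (M.map k (edgePoint e t)) w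
  have h1 := eventually_nhdsWithin_sign_eq_of_deriv_neg (by rwa [hder.deriv])
    (by simp [hG0, bary_edgePoint_opp])
  have h2 := hray.eventually (M.eventually_preimage_mem k (edgePoint_mem ht e) hGl)
  filter_upwards [h1.filter_mono nhdsWithin_le_nhds, h2.filter_mono nhdsWithin_le_nhds,
    self_mem_nhdsWithin] with s hs1 hs2 hs
  rintro ⟨ξ, hξ, h⟩
  have h3 : G (M.map k ξ) = ξ := hs2 ξ hξ h
  rw [zero_sub, sign_neg (neg_lt_zero.2 (mem_Ioi.1 hs)), sign_eq_neg_one_iff, ← h, h3] at hs1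
  exact absurd (mem_refTriangle_iff_bary.1 hξ (oppVertex e)) (not_le.2 hs1)

/-! ### Orientation of the elements -/

/-- The sign of the Jacobian determinant of an element. -/
noncomputable def detSign (k : K) : ℝ :=
  SignType.sign (fderiv ℝ (M.map k) (edgePoint 0 0)).det

/-- The determinant is continuous and nonvanishing on a connected set, so its sign is constant. -/
lemma abs_det (k : K) {ξ : Plane} (hξ : ξ ∈ refTriangle) :
    |(fderiv ℝ (M.map k) ξ).det| = M.detSign k * (fderiv ℝ (M.map k) ξ).det := by
  have hpre := convex_refTriangle.isPreconnected
  have h0 : edgePoint 0 0 ∈ refTriangle := edgePoint_mem (by simp) 0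
  have hcont := M.continuousOn_det k
  have hne := M.det_ne_zero k
  have key : SignType.sign (fderiv ℝ (M.map k) ξ).det =
      SignType.sign (fderiv ℝ (M.map k) (edgePoint 0 0)).det := by
    rcases lt_or_gt_of_ne (hne ξ hξ) with h | h <;> rcases lt_or_gt_of_ne (hne _ h0) with h' | h'
    · rw [sign_neg h, sign_neg h']
    · obtain ⟨ζ, hζ, hz⟩ := hpre.intermediate_value hξ h0 hcont ⟨h.le, h'.le⟩
      exact absurd hz (hne ζ hζ)
    · obtain ⟨ζ, hζ, hz⟩ := hpre.intermediate_value h0 hξ hcont ⟨h'.le, h.le⟩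
      exact absurd hz (hne ζ hζ)
    · rw [sign_pos h, sign_pos h']
  rw [detSign, ← key, sign_mul_self]

lemma detSign_eq (k : K) : M.detSign k = 1 ∨ M.detSign k = -1 := by
  have h := M.det_ne_zero k (edgePoint 0 0) (edgePoint_mem (by simp) 0)
  rcases lt_or_gt_of_ne h with h | h
  · right; simp [detSign, sign_neg h]
  · left; simp [detSign, sign_pos h]

/-- The sign `1` if the element lies on the left of its edge, and `-1` otherwise. -/
noncomputable def orient (z : K × Fin 3) : ℝ := M.detSign z.1 * edgeSign z.2

lemma orient_eq (z : K × Fin 3) : M.orient z = 1 ∨ M.orient z = -1 := by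
  obtain ⟨k, e⟩ := z
  have he : edgeSign e = 1 ∨ edgeSign e = -1 := by fin_cases e <;> simp [edgeSign]
  rcases M.detSign_eq k with h | h <;> rcases he with h' | h' <;> simp [orient, h, h']

/-- Applied to the slope of the opposite coordinate, with `r` the signed area of the tangent and a
direction: `orient` alone decides whether that direction enters the element. -/
lemma edgeSign_div_det (z : K × Fin 3) {ξ : Plane} (hξ : ξ ∈ refTriangle) (r : ℝ) :
    edgeSign z.2 * r / (fderiv ℝ (M.map z.1) ξ).det =
      M.orient z * r / |(fderiv ℝ (M.map z.1) ξ).det| := by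
  rw [M.abs_det z.1 hξ, orient]
  have h := M.det_ne_zero z.1 ξ hξ
  rcases M.detSign_eq z.1 with h' | h' <;> rw [h'] <;> field_simp

/-! ### Elements that share an edge -/

/-- The global vertices of an edge of an element. -/
def ends (z : K × Fin 3) : V × V := (M.vtx z.1 (edgeStart z.2), M.vtx z.1 (edgeEnd z.2))

lemma map_edgePoint_congr {z z' : K × Fin 3} (h : M.ends z = M.ends z') {t : ℝ}
    (ht : t ∈ Icc (0 : ℝ) 1) : M.map z.1 (edgePoint z.2 t) = M.map z'.1 (edgePoint z'.2 t) := by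
  have key : ∀ z : K × Fin 3, ∑ i, Finsupp.single (M.vtx z.1 i) (bary (edgePoint z.2 t) i) =
      Finsupp.single (M.ends z).1 (1 - t) + Finsupp.single (M.ends z).2 t := by
    rintro ⟨k, e⟩
    have h1 := bary_edgePoint_start e t
    have h2 := bary_edgePoint_end e t
    have h3 := bary_edgePoint_opp e t
    fin_cases e <;> simp [edgeStart, edgeEnd, oppVertex] at h1 h2 h3 <;>
      simp [Fin.sum_univ_three, ends, edgeStart, edgeEnd, h1, h2, h3]
  rw [M.glue _ _ _ (edgePoint_mem ht _) _ (edgePoint_mem ht _), key, key, h]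

lemma tangent_congr {z z' : K × Fin 3} (h : M.ends z = M.ends z') {t : ℝ}
    (ht : t ∈ Ioo (0 : ℝ) 1) : M.tangent z.1 z.2 t = M.tangent z'.1 z'.2 t := by
  have key : ∀ z : K × Fin 3, HasDerivAt (fun s => M.map z.1 (edgePoint z.2 s))
      (M.tangent z.1 z.2 t) t := fun z =>
    (M.hasFDerivAt z.1 (edgePoint_mem (Ioo_subset_Icc_self ht) z.2)).comp_hasDerivAt t
      (hasDerivAt_edgePoint z.2 t)
  refine (key z).unique ((key z').congr_of_eventuallyEq ?_)
  filter_upwards [Icc_mem_nhds ht.1 ht.2] with s hs using M.map_edgePoint_congr h hs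

lemma exists_det2_tangent_eq (z : K × Fin 3) {t : ℝ} (ht : t ∈ Icc (0 : ℝ) 1) (r : ℝ) :
    ∃ w, det2 (M.tangent z.1 z.2 t) w = r := by
  have hmem := edgePoint_mem ht z.2
  have hdet := M.det_ne_zero z.1 _ hmem
  set J := fderiv ℝ (M.map z.1) (edgePoint z.2 t)
  obtain ⟨v, hv⟩ : ∃ v, det2 (edgeTangent z.2) v = r / J.det := by
    -- The witness is the tangent turned by a right angle and rescaled.
    refine ⟨!₂[-(edgeTangent z.2 1) * (r / J.det) / (edgeTangent z.2 0 ^ 2 + edgeTangent z.2 1 ^ 2),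
      edgeTangent z.2 0 * (r / J.det) / (edgeTangent z.2 0 ^ 2 + edgeTangent z.2 1 ^ 2)], ?_⟩
    have hpos : edgeTangent z.2 0 ^ 2 + edgeTangent z.2 1 ^ 2 ≠ 0 := by
      obtain ⟨k, e⟩ := z
      fin_cases e <;> simp [edgeTangent, edgeStart, edgeEnd, refVertex]
    simp only [det2]
    simp
    field_simp
    ring
  exact ⟨J v, by rw [tangent, det2_map, hv]; exact mul_div_cancel₀ r hdet⟩

/-- Two elements on the same side of an edge both contain, in their interiors, the start of a ray
into that side, so they coincide. -/
lemma eq_of_ends_eq_of_orient_eq {z z' : K × Fin 3} (h : M.ends z = M.ends z')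
    (ho : M.orient z = M.orient z') : z = z' := by
  have ht : (1 / 2 : ℝ) ∈ Ioo (0 : ℝ) 1 := by norm_num
  have ht' := Ioo_subset_Icc_self ht
  -- With this value the slope has the sign of `orient` squared, which is positive.
  obtain ⟨w, hw⟩ := M.exists_det2_tangent_eq z ht' (M.orient z)
  have hpos : ∀ z : K × Fin 3, 0 < M.orient z * M.orient z /
      |(fderiv ℝ (M.map z.1) (edgePoint z.2 (1 / 2))).det| := fun z => by
    refine div_pos ?_ (abs_pos.2 (M.det_ne_zero z.1 _ (edgePoint_mem ht' _)))
    rcases M.orient_eq z with h | h <;> simp [h]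
  have h1 := M.eventually_mem_image_interior z.1 z.2 ht (w := w) (by
    rw [M.edgeSign_div_det z (edgePoint_mem ht' _), hw]; exact hpos z)
  have h2 := M.eventually_mem_image_interior z'.1 z'.2 ht (w := w) (by
    rw [M.edgeSign_div_det z' (edgePoint_mem ht' _), ← M.tangent_congr h ht, hw, ho]
    exact hpos z')
  rw [← M.map_edgePoint_congr h ht'] at h2
  obtain ⟨s, ⟨ξ, hξ, hs1⟩, ⟨ζ, hζ, hs2⟩⟩ := (h1.and h2).exists
  have hk : z.1 = z'.1 := M.eq_of_map_interior_eq hξ hζ (hs1.trans hs2.symm)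
  obtain ⟨k, e⟩ := z
  obtain ⟨l, f⟩ := z'
  dsimp only at hk
  subst hk
  have he1 := M.vtx_injective k (congrArg Prod.fst h)
  have he2 := M.vtx_injective k (congrArg Prod.snd h)
  have : ∀ e f : Fin 3, edgeStart e = edgeStart f → edgeEnd e = edgeEnd f → e = f := by decide
  rw [this e f he1 he2]

/-- Both ends of the edge have nonzero weight, so they are vertices of `l`; `oriented` puts them in
the right order. -/
lemma exists_edge_of_mem_image {z : K × Fin 3} {t : ℝ} (ht : t ∈ Ioo (0 : ℝ) 1) {l : K}
    (h : M.map z.1 (edgePoint z.2 t) ∈ M.map l '' refTriangle) :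
    ∃ f, M.ends (l, f) = M.ends z := by
  obtain ⟨ζ, hζ, h⟩ := h
  have hz := edgePoint_mem (Ioo_subset_Icc_self ht) z.2
  obtain ⟨i, hi, -⟩ := M.exists_vtx_eq hz hζ h.symm (i := edgeStart z.2)
    (by rw [bary_edgePoint_start]; linarith [ht.2])
  obtain ⟨j, hj, -⟩ := M.exists_vtx_eq hz hζ h.symm (i := edgeEnd z.2)
    (by rw [bary_edgePoint_end]; exact ht.1.ne')
  have hlt : ∀ e, edgeStart e < edgeEnd e := by decide
  have hij := M.oriented _ _ _ _ _ _ hi.symm hj.symm (hlt z.2)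
  have : ∀ i j : Fin 3, i < j → ∃ f, edgeStart f = i ∧ edgeEnd f = j := by decide
  obtain ⟨f, rfl, rfl⟩ := this i j hij
  exact ⟨f, Prod.ext hi hj⟩

/-- If no element lay on the side `σ`, a ray into that side would leave every element at once, yet
it stays in the open set `A`, which the elements cover. -/
lemma exists_orient_eq [Finite K] {A : Set Plane} (hA : M.IsMeshOf A) {z : K × Fin 3} {t : ℝ}
    (ht : t ∈ Ioo (0 : ℝ) 1) (hx : M.map z.1 (edgePoint z.2 t) ∈ A) {σ : ℝ} (hσ : σ = 1 ∨ σ = -1) :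
    ∃ z', M.ends z' = M.ends z ∧ M.orient z' = σ := by
  by_contra! hcon
  have ht' := Ioo_subset_Icc_self ht
  obtain ⟨w, hw⟩ := M.exists_det2_tangent_eq z ht' σ
  have hray := tendsto_ray (M.map z.1 (edgePoint z.2 t)) w
  have h1 : ∀ᶠ s in 𝓝[>] (0 : ℝ), ∀ l,
      M.map z.1 (edgePoint z.2 t) + s • w ∉ M.map l '' refTriangle := by
    rw [eventually_all]
    intro l
    by_cases hl : M.map z.1 (edgePoint z.2 t) ∈ M.map l '' refTriangle
    · obtain ⟨f, hf⟩ := M.exists_edge_of_mem_image ht hl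
      rw [← M.map_edgePoint_congr hf ht']
      refine M.eventually_notMem_image l f ht' ?_
      rw [M.edgeSign_div_det (l, f) (edgePoint_mem ht' _), M.tangent_congr hf ht, hw]
      refine div_neg_of_neg_of_pos ?_ (abs_pos.2 (M.det_ne_zero l _ (edgePoint_mem ht' _)))
      have hne := hcon (l, f) hf
      rcases M.orient_eq (l, f) with h | h <;> rcases hσ with h' | h' <;> rw [h, h'] at hne ⊢ <;>
        first | exact absurd rfl hne | norm_num
    -- Elements that miss the point are closed, hence avoided nearby.
    · exact (hray.eventually ((M.isClosed_image l).isOpen_compl.mem_nhds hl)).filter_mono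
        nhdsWithin_le_nhds
  have h2 : ∀ᶠ s in 𝓝[>] (0 : ℝ), M.map z.1 (edgePoint z.2 t) + s • w ∈ A :=
    (hray.eventually (hA.1.mem_nhds hx)).filter_mono nhdsWithin_le_nhds
  obtain ⟨s, hs1, hs2⟩ := (h1.and h2).exists
  have := subset_closure hs2
  rw [hA.2, mem_iUnion] at this
  obtain ⟨l, hl⟩ := this
  exact hs1 l hl

open Classical in
/-- The two elements at an edge inside the domain lie on different sides of it. -/
lemma sum_orient_eq_zero [Fintype K] {A : Set Plane} (hA : M.IsMeshOf A) {z : K × Fin 3} {t : ℝ}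
    (ht : t ∈ Ioo (0 : ℝ) 1) (hx : M.map z.1 (edgePoint z.2 t) ∈ A) :
    ∑ z' with M.ends z' = M.ends z, M.orient z' = 0 := by
  obtain ⟨z₁, he₁, ho₁⟩ := M.exists_orient_eq hA ht hx (Or.inl rfl)
  obtain ⟨z₂, he₂, ho₂⟩ := M.exists_orient_eq hA ht hx (Or.inr rfl)
  have hne : z₁ ≠ z₂ := by
    rintro rfl
    rw [ho₁] at ho₂
    norm_num at ho₂
  have : (Finset.univ.filter fun z' => M.ends z' = M.ends z) = {z₁, z₂} := by
    ext z'
    simp only [Finset.mem_filter, Finset.mem_univ, true_and, Finset.mem_insert,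
      Finset.mem_singleton]
    constructor
    · intro h
      rcases M.orient_eq z' with h' | h'
      · exact Or.inl (M.eq_of_ends_eq_of_orient_eq (h.trans he₁.symm) (h'.trans ho₁.symm))
      · exact Or.inr (M.eq_of_ends_eq_of_orient_eq (h.trans he₂.symm) (h'.trans ho₂.symm))
    · rintro (rfl | rfl) <;> assumption
  rw [this, Finset.sum_pair hne, ho₁, ho₂]
  norm_num

end Mesh

/-! ### Conformity -/

namespace Mesh

variable {V K : Type*} (M : Mesh V K)

lemma continuousOn_piola (k : K) (φ : PolyField) :
    ContinuousOn (piola (M.map k) φ) refTriangle := by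
  have hφ : Continuous (evalField φ) := by
    have h := fun i => (contDiff_evalPoly (φ i)).continuous
    refine (PiLp.continuous_toLp 2 _).comp (continuous_pi fun i => ?_)
    fin_cases i
    · exact h 0
    · exact h 1
  exact (continuousOn_const.div (M.continuousOn_det k) (M.det_ne_zero k)).smul
    ((M.continuousOn_fderiv k).clm_apply hφ.continuousOn)

lemma continuousOn_divPoly_div_det (k : K) (φ : PolyField) :
    ContinuousOn (fun ξ => evalPoly (divPoly φ) ξ / (fderiv ℝ (M.map k) ξ).det) refTriangle :=
  (contDiff_evalPoly _).continuous.continuousOn.div (M.continuousOn_det k) (M.det_ne_zero k)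

/-- Green's formula on an element, in terms of the Piola transformation. -/
lemma green_piola (k : K) (φ : PolyField) {q : Plane → ℝ} (hq : ContDiff ℝ 1 q) :
    (∫ ξ in refTriangle, |(fderiv ℝ (M.map k) ξ).det| •
        fderiv ℝ q (M.map k ξ) (piola (M.map k) φ ξ)) +
      ∫ ξ in refTriangle, |(fderiv ℝ (M.map k) ξ).det| •
        (evalPoly (divPoly φ) ξ / (fderiv ℝ (M.map k) ξ).det * q (M.map k ξ)) =
    ∑ e, M.orient (k, e) *
      ∫ t in (0 : ℝ)..1, edgeFlux e φ t * q (M.map k (edgePoint e t)) := by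
  obtain ⟨O, hO, hΓ, h⟩ := M.contDiff k
  have hgreen := green_refTriangle hO (hq.comp_contDiffOn h) hΓ φ
  have hqc := hq.continuous.comp_continuousOn (M.continuousOn_map k)
  have hdq : ContinuousOn (fun ξ => fderiv ℝ q (M.map k ξ) (piola (M.map k) φ ξ)) refTriangle :=
    ((hq.continuous_fderiv one_ne_zero).comp_continuousOn (M.continuousOn_map k)).clm_apply
      (M.continuousOn_piola k φ)
  rw [← integral_add]
  -- By the chain rule, `|det|` times the factor `1 / det` of the Piola map leaves only the constant
  -- `detSign`.
  · have key : ∀ ξ ∈ refTriangle, |(fderiv ℝ (M.map k) ξ).det| •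
          fderiv ℝ q (M.map k ξ) (piola (M.map k) φ ξ) + |(fderiv ℝ (M.map k) ξ).det| •
          (evalPoly (divPoly φ) ξ / (fderiv ℝ (M.map k) ξ).det * q (M.map k ξ)) =
        M.detSign k * (fderiv ℝ (q ∘ M.map k) ξ (evalField φ ξ) +
          evalPoly (divPoly φ) ξ * (q ∘ M.map k) ξ) := by
      intro ξ hξ
      have hd := M.det_ne_zero k ξ hξ
      rw [fderiv_comp ξ (hq.differentiable one_ne_zero _)
        (M.hasFDerivAt k hξ).differentiableAt, M.abs_det k hξ, piola, map_smul]
      simp only [ContinuousLinearMap.comp_apply, smul_eq_mul, Function.comp_apply]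
      field_simp
    rw [setIntegral_congr_fun isClosed_refTriangle.measurableSet key, integral_const_mul, hgreen,
      Finset.mul_sum]
    exact Finset.sum_congr rfl fun e _ => (mul_assoc _ _ _).symm
  · exact ((M.continuousOn_det k).abs.smul hdq).integrableOn_compact isCompact_refTriangle
  · exact ((M.continuousOn_det k).abs.smul
      ((M.continuousOn_divPoly_div_det k φ).mul hqc)).integrableOn_compact isCompact_refTriangle

/-- The contributions of the elements at the edges cancel if the flux densities agree. -/
lemma sum_orient_mul_eq_zero [Fintype K] {A : Set Plane} (hA : M.IsMeshOf A) {q : Plane → ℝ}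
    (hq : ∀ y ∉ A, q y = 0) (F : V × V → ℝ) {t : ℝ} (ht : t ∈ Ioo (0 : ℝ) 1) :
    ∑ z : K × Fin 3, M.orient z * (F (M.ends z) * q (M.map z.1 (edgePoint z.2 t))) = 0 := by
  classical
  rw [← Finset.sum_fiberwise_of_maps_to (t := Finset.univ.image M.ends) (g := M.ends)
    (fun z _ => Finset.mem_image_of_mem _ (Finset.mem_univ z))]
  refine Finset.sum_eq_zero fun b hb => ?_
  obtain ⟨z, -, rfl⟩ := Finset.mem_image.1 hb
  have hcongr : ∀ z' ∈ Finset.univ.filter fun z' => M.ends z' = M.ends z,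
      M.orient z' * (F (M.ends z') * q (M.map z'.1 (edgePoint z'.2 t))) =
      M.orient z' * (F (M.ends z) * q (M.map z.1 (edgePoint z.2 t))) := by
    intro z' hz'
    have h := (Finset.mem_filter.1 hz').2
    rw [h, M.map_edgePoint_congr h (Ioo_subset_Icc_self ht)]
  rw [Finset.sum_congr rfl hcongr, ← Finset.sum_mul]
  -- Off `A` the test function is zero, so nothing is needed about how many elements meet there.
  by_cases hx : M.map z.1 (edgePoint z.2 t) ∈ A
  · rw [M.sum_orient_eq_zero hA ht hx, zero_mul]
  · rw [hq _ hx, mul_zero, mul_zero]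

/-- A field that is a Piola image on each element belongs to `H(div, A)` if the flux densities of
the elements that share an edge agree. -/
lemma mem_HDiv_of_edgeFlux [Finite K] {A : Set Plane} (hA : M.IsMeshOf A) {u : Plane → Plane}
    {φ : K → PolyField}
    (hu : ∀ k, ∀ ξ ∈ interior refTriangle, u (M.map k ξ) = piola (M.map k) (φ k) ξ)
    {F : V × V → ℝ → ℝ}
    (hF : ∀ z : K × Fin 3, ∀ t ∈ Ioo (0 : ℝ) 1, edgeFlux z.2 (φ z.1) t = F (M.ends z) t) :
    u ∈ HDiv A := by
  have := Fintype.ofFinite K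
  -- The weak divergence is the Piola transform of the divergence on the reference triangle, element
  -- by element.
  obtain ⟨d, hd⟩ := M.exists_eq_on_interiors fun k ξ =>
    evalPoly (divPoly (φ k)) ξ / (fderiv ℝ (M.map k) ξ).det
  refine ⟨M.memLp_two hA (fun k => M.continuousOn_piola k (φ k)) hu, d,
    M.memLp_two hA (fun k => M.continuousOn_divPoly_div_det k (φ k)) hd, fun q hq _ hqA => ?_⟩
  have hq1 : ContDiff ℝ 1 q := hq.of_le (by exact_mod_cast le_top)
  have hq0 : ∀ y ∉ A, q y = 0 := fun y hy => image_eq_zero_of_notMem_tsupport fun h => hy (hqA h)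
  have hq0' : ∀ y ∉ A, fderiv ℝ q y (u y) = 0 := fun y hy => by
    rw [fderiv_of_notMem_tsupport ℝ fun h => hy (hqA h)]; rfl
  rw [← sub_eq_zero, sub_neg_eq_add,
    M.setIntegral_eq_sum hA (g := fun k ξ => fderiv ℝ q (M.map k ξ) (piola (M.map k) (φ k) ξ))
      (fun k => ((hq1.continuous_fderiv one_ne_zero).comp_continuousOn
        (M.continuousOn_map k)).clm_apply (M.continuousOn_piola k (φ k)))
      (fun k ξ hξ => by rw [hu k ξ hξ]) hq0',
    M.setIntegral_eq_sum hA (g := fun k ξ =>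
        evalPoly (divPoly (φ k)) ξ / (fderiv ℝ (M.map k) ξ).det * q (M.map k ξ))
      (fun k => (M.continuousOn_divPoly_div_det k (φ k)).mul
        (hq1.continuous.comp_continuousOn (M.continuousOn_map k)))
      (fun k ξ hξ => by rw [hd k ξ hξ]) (fun y hy => by rw [hq0 y hy, mul_zero]),
    ← Finset.sum_add_distrib, Finset.sum_congr rfl fun k _ => M.green_piola k (φ k) hq1,
    ← Fintype.sum_prod_type' (f := fun k e => M.orient (k, e) *
      ∫ t in (0 : ℝ)..1, edgeFlux e (φ k) t * q (M.map k (edgePoint e t)))]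
  simp only [← intervalIntegral.integral_const_mul]
  -- The sum goes under a single integral because the edge terms cancel for each parameter
  -- separately; the endpoints, where the fluxes are not compared, are dropped.
  rw [← intervalIntegral.integral_finsetSum, intervalIntegral.integral_of_le zero_le_one,
    integral_Ioc_eq_integral_Ioo]
  · refine setIntegral_eq_zero_of_forall_eq_zero fun t ht => ?_
    rw [← M.sum_orient_mul_eq_zero hA hq0 (fun b => F b t) ht]
    exact Finset.sum_congr rfl fun z _ => by rw [hF z t ht]
  · intro z _
    refine ContinuousOn.intervalIntegrable ?_
    rw [uIcc_of_le zero_le_one]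
    exact continuousOn_const.mul ((continuous_edgeFlux z.2 (φ z.1)).continuousOn.mul
      ((hq1.continuous.comp_continuousOn (M.continuousOn_map z.1)).comp
        (continuous_edgePoint z.2).continuousOn fun t ht => edgePoint_mem ht z.2))

end Mesh

end RTTemplate

theorem mainTheorem8 {p : ℕ}
    (U : 1 ≤ p → RTTemplate.PolytopalBasis p)
    (U' : RTTemplate.PolytopalBasis (p + 1)) (hU' : U'.EdgeConforming)
    {V K : Type*} [Finite K] (M : RTTemplate.Mesh V K)
    (A : Set RTTemplate.Plane) (hA : M.IsMeshOf A) :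
    RTTemplate.rtSpace M U U' ⊆ RTTemplate.HDiv A := by
  rintro u ⟨c, w, hw, hu⟩
  exact M.mem_HDiv_of_edgeFlux hA hu
    (F := fun b t => ∑ m, c b.1 b.2 m * RTTemplate.edgeTrace U' m t)
    fun z t ht => RTTemplate.edgeFlux_combination hU'
      (fun e => c (M.vtx z.1 (RTTemplate.edgeStart e)) (M.vtx z.1 (RTTemplate.edgeEnd e)))
      (hw z.1) z.2 ht
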